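/- Let $\Sigma$ be a finite alphabet, $\mathsf{Exp}$ the set of regular expressions over $\Sigma$, $[\![g]\!]$ the regular language of $g$, and let $H=\{e\le w\}$ with $e\in\mathsf{Exp}$ and $w\in\Sigma^*$ ($w$ is also read as the product of its letters). **Equivalence and semantics.** $\mathsf{KA}_H$ is the proof system of Kleene algebra with the additional axiom $e+w=w$ (letters are not universally quantified), and $\equiv_H$ is provable equality in it. For a language $L$ let $H(L)=L\cup\bigcup\{u[\![e]\!]v : uwv\in L\}$, let $H^*(L)$ be the smallest language $M\supseteq L$ with $H(M)=M$, and put $[\![g]\!]_H=H^*([\![g]\!])$. **Automata.** An automaton has a set of states, transitions labelled in $\Sigma\cup\{\epsilon\}$, one initial and one final state. Write $x\xrightarrow{v}{}^{*}x'$ for the reflexive-transitive extension of the transitions to words $v$, and $l_{\mathcal X}(x)$ for the language accepted by the state $x$ of $\mathcal X$. Fix any translation assigning to each expression $g$ a finite automaton $\mathcal X_g$ with language $[\![g]\!]$ (for instance Thompson's construction), and let $\mathcal Z=\mathcal X_e$, with initial state $z_0$ and final state $z_\oplus$. * The $w$-saturation $\mathcal Z^w$ has the states of $\mathcal Z$ and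 the smallest transition relation $\to_S$ that contains that of $\mathcal Z$ and satisfies: if $z\xrightarrow{w}{}^{*}_{S}z_\oplus$ then $z\xrightarrow{\epsilon}_S z_0$; if $z_0\xrightarrow{w}{}^{*}_{S}z$ then $z_\oplus\xrightarrow{\epsilon}_S z$. * $T_H(\mathcal X)$ arises from $\mathcal X$ as follows, simultaneously for all states $x$ such that not every $v$ with $wv\in l_{\mathcal X}(x)$ satisfies $[\![e]\!]v\subseteq l_{\mathcal X}(x)$: add a fresh copy of $\mathcal Z^w$, an $\epsilon$-transition from $x$ to the copy of $z_0$, and an $\epsilon$-transition from the copy of $z_\oplus$ to each state $x'$ of $\mathcal X$ with $x\xrightarrow{w}{}^{*}_{\mathcal X}x'$. The initial and final states are those of $\mathcal X$. * $T_H^*(\mathcal X)$ is the limit (union) of the chain $\mathcal X\sqsubseteq T_H(\mathcal X)\sqsubseteq T_H^2(\mathcal X)\sqsubseteq\cdots$. The partial function $r_H:\mathsf{Exp}\rightharpoonup\mathsf{Exp}$ is defined on $g$ if and only if $T_H^*(\mathcal X_g)$ is finite; $r_H(g)$ is then the value at the initial state of a least solution (in Kleene algebra) of the automaton $T_H^*(\mathcal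 X_g)$. **Corollary.** 1. If $r_H$ is defined on $g$ and $h$ and $[\![g]\!]_H=[\![h]\!]_H$, then $g\equiv_H h$. 2. $\equiv_H$ is decidable on such pairs: there is an algorithm that, on input any pair $(g,h)$ of expressions on both of which $r_H$ is defined, halts and correctly answers whether $g\equiv_H h$. 3. Consequently, if $r_H$ is defined on every expression, i.e. $T_H^*(\mathcal X_g)$ is finite for all $g\in\mathsf{Exp}$, then $\mathsf{KA}_H$ is complete (for all $g,h\in\mathsf{Exp}$, $[\![g]\!]_H=[\![h]\!]_H$ implies $g\equiv_H h$) and the relation $\equiv_H$ on $\mathsf{Exp}$ is decidable. -/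

import Mathlib

open Computability

namespace KAHyp

universe u

/-- Regular expressions over the alphabet `α`; `g.matches'` is the regular language of `g`. -/
abbrev Exp (α : Type u) : Type u := RegularExpression α

/-! ### Provable equivalence in Kleene algebra with hypotheses -/

/-- `KAEq H e f` : the equation `e = f` is derivable in Kleene algebra from the hypotheses `g ≤ h`
with `(g, h) ∈ H`, i.e. `KAEq H` is the least congruence satisfying the rules of Kleene algebra and
all hypotheses. An inequation `e ≤ f` is shorthand for `e + f = f`. Letters in the hypotheses are
not universally quantified. -/
inductive KAEq {α : Type u} (H : Set (Exp α × Exp α)) : Exp α → Exp α → Prop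
  | refl (e : Exp α) : KAEq H e e
  | symm {e f : Exp α} : KAEq H e f → KAEq H f e
  | trans {e f g : Exp α} : KAEq H e f → KAEq H f g → KAEq H e g
  | add_congr {e e' f f' : Exp α} : KAEq H e e' → KAEq H f f' → KAEq H (e + f) (e' + f')
  | mul_congr {e e' f f' : Exp α} : KAEq H e e' → KAEq H f f' → KAEq H (e * f) (e' * f')
  | star_congr {e e' : Exp α} : KAEq H e e' → KAEq H e.star e'.star
  | add_zero (e : Exp α) : KAEq H (e + 0) e
  | add_idem (e : Exp α) : KAEq H (e + e) e
  | add_comm (e f : Exp α) : KAEq H (e + f) (f + e)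
  | add_assoc (e f g : Exp α) : KAEq H (e + (f + g)) ((e + f) + g)
  | mul_zero (e : Exp α) : KAEq H (e * 0) 0
  | zero_mul (e : Exp α) : KAEq H (0 * e) 0
  | mul_one (e : Exp α) : KAEq H (e * 1) e
  | one_mul (e : Exp α) : KAEq H (1 * e) e
  | mul_assoc (e f g : Exp α) : KAEq H (e * (f * g)) ((e * f) * g)
  | mul_add (e f g : Exp α) : KAEq H (e * (f + g)) (e * f + e * g)
  | add_mul (e f g : Exp α) : KAEq H ((e + f) * g) (e * g + f * g)
  | star_unfold_left (e : Exp α) : KAEq H (1 + e * e.star) e.star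
  | star_unfold_right (e : Exp α) : KAEq H (1 + e.star * e) e.star
  | star_induct_left {e f g : Exp α} :
      KAEq H ((e + f * g) + g) g → KAEq H (f.star * e + g) g
  | star_induct_right {e f g : Exp α} :
      KAEq H ((e + f * g) + f) f → KAEq H (e * g.star + f) f
  | hyp {e f : Exp α} : (e, f) ∈ H → KAEq H (e + f) f

/-- `e ≤ f` is derivable from the hypotheses `H`. -/
def KALe {α : Type u} (H : Set (Exp α × Exp α)) (e f : Exp α) : Prop := KAEq H (e + f) f

/-- A word, as a regular expression. -/
def ofWord {α : Type u} : List α → Exp α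
  | [] => 1
  | a :: w => RegularExpression.char a * ofWord w

/-- The set consisting of the single linear hypothesis `e ≤ w`. -/
def linHyp {α : Type u} (e : Exp α) (w : List α) : Set (Exp α × Exp α) := {(e, ofWord w)}

/-! ### Hypothesis closure semantics -/

/-- The one-step hypothesis closure
`L ↦ L ∪ ⋃ {u ⟦e⟧ v : u ⟦f⟧ v ⊆ L, (e ≤ f) ∈ H}`. -/
def hypStep {α : Type u} (H : Set (Exp α × Exp α)) (L : Language α) : Language α :=
  {x | x ∈ L ∨ ∃ (e f : Exp α) (u v : List α), (e, f) ∈ H ∧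
    (∀ y ∈ f.matches', u ++ y ++ v ∈ L) ∧ ∃ y ∈ e.matches', x = u ++ y ++ v}

/-- The hypothesis closure of `L`: the smallest language containing `L` that is a fixed point of
the one-step closure. -/
def hypClosure {α : Type u} (H : Set (Exp α × Exp α)) (L : Language α) : Language α :=
  {x | ∀ M : Language α, L ≤ M → hypStep H M = M → x ∈ M}

theorem hypClosure_isLeast {α : Type u} (H : Set (Exp α × Exp α)) (L : Language α) :
    IsLeast {M : Language α | L ≤ M ∧ hypStep H M = M} (hypClosure H L) := by
  refine ⟨⟨fun x hx M hM _ => hM hx, ?_⟩, fun M hM x hx => hx M hM.1 hM.2⟩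
  ext x
  refine ⟨?_, fun hx => Or.inl hx⟩
  rintro (hx | ⟨e, f, u, v, hef, hf, y, hy, rfl⟩)
  · exact hx
  · intro M hLM hM
    rw [← hM]
    exact Or.inr ⟨e, f, u, v, hef, fun z hz => hf z hz M hLM hM, y, hy, rfl⟩

/-- The hypothesis closure semantics of an expression. -/
def semH {α : Type u} (H : Set (Exp α × Exp α)) (g : Exp α) : Language α :=
  hypClosure H g.matches'

/-! ### Automata -/

/-- The extension of a transition relation to words: the reflexive and transitive closure. -/
inductive Trace {α : Type u} {X : Type} (step : X → Option α → X → Prop) :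
    X → List α → X → Prop
  | refl (x : X) : Trace step x [] x
  | letter {x x' : X} {a : α} : step x (some a) x' → Trace step x [a] x'
  | eps {x x' : X} : step x none x' → Trace step x [] x'
  | append {x x' x'' : X} {v v' : List α} :
      Trace step x v x' → Trace step x' v' x'' → Trace step x (v ++ v') x''

/-- Nondeterministic automata with `ε`-transitions (labelled `none`), one initial and one final
state, and a possibly infinite set of states. -/
structure Automaton (α : Type u) where
  State : Type
  step : State → Option α → State → Prop
  final : State
  start : State

namespace Automaton

variable {α : Type u}

/-- The language accepted by the state `x`. -/
def langFrom (X : Automaton α) (x : X.State) : Language α :=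
  {v | Trace X.step x v X.final}

/-- The language accepted by the automaton. -/
def lang (X : Automaton α) : Language α := X.langFrom X.start

/-- A solution to an automaton, up to provable equivalence in Kleene algebra. -/
structure IsSolution (X : Automaton α) (s : X.State → Exp α) : Prop where
  final : KALe ∅ 1 (s X.final)
  letter : ∀ (x x' : X.State) (a : α), X.step x (some a) x' →
    KALe ∅ (RegularExpression.char a * s x') (s x)
  eps : ∀ x x' : X.State, X.step x none x' → KALe ∅ (s x') (s x)

/-- A least solution to an automaton. -/
def IsLeastSolution (X : Automaton α) (s : X.State → Exp α) : Prop :=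
  X.IsSolution s ∧ ∀ s', X.IsSolution s' → ∀ x, KALe ∅ (s x) (s' x)

/-- The regular expression for the initial state of `X`: the value there of a least solution. (Least
solutions to finite automata exist, and are unique up to provable equivalence.) -/
noncomputable def toExp (X : Automaton α) : Exp α :=
  Classical.epsilon (fun s : X.State → Exp α => X.IsLeastSolution s) X.start

/-! ### Saturation and patching -/

/-- The rules for the transition relation of the `w`-saturation of `Z`: it contains the transitions
of `Z`, the initial state resets and the final state resets. -/
structure SatRules (Z : Automaton α) (w : List α)
    (R : Z.State → Option α → Z.State → Prop) : Prop where
  base : ∀ z a z', Z.step z a z' → R z a z'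
  startReset : ∀ z, Trace R z w Z.final → R z none Z.start
  finalReset : ∀ z, Trace R Z.start w z → R Z.final none z

/-- The `w`-saturation of `Z`: its transition relation is the smallest one that satisfies
the rules above. -/
def saturate (Z : Automaton α) (w : List α) : Automaton α where
  State := Z.State
  step z a z' := ∀ R, Z.SatRules w R → R z a z'
  final := Z.final
  start := Z.start

/-- Transitions after simultaneously `w`-patching a copy of `Z` at each state in `P`. -/
inductive PatchStep (X Z : Automaton α) (w : List α) (P : Set X.State) :
    X.State ⊕ (P × Z.State) → Option α → X.State ⊕ (P × Z.State) → Prop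
  | old {y y' : X.State} {a : Option α} : X.step y a y' →
      PatchStep X Z w P (Sum.inl y) a (Sum.inl y')
  | copy (p : P) {z z' : Z.State} {a : Option α} : Z.step z a z' →
      PatchStep X Z w P (Sum.inr (p, z)) a (Sum.inr (p, z'))
  | enter (p : P) :
      PatchStep X Z w P (Sum.inl p.1) none (Sum.inr (p, Z.start))
  | exit (p : P) {x' : X.State} : Trace X.step p.1 w x' →
      PatchStep X Z w P (Sum.inr (p, Z.final)) none (Sum.inl x')

/-- `X` with a separate copy of `Z` `w`-patched at each state in `P`, all patches being made
simultaneously. -/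
def patch (X Z : Automaton α) (w : List α) (P : Set X.State) : Automaton α where
  State := X.State ⊕ (P × Z.State)
  step := PatchStep X Z w P
  final := Sum.inl X.final
  start := Sum.inl X.start

/-- The generalised Brzozowski derivative (left residual) of `L` with respect to `M`. -/
def residual (M L : Language α) : Language α := {v | ∀ y ∈ M, y ++ v ∈ L}

/-- The states that have to be patched, for the hypothesis `e ≤ w`: those with
`w⁻¹ l(x) ⊈ ⟦e⟧⁻¹ l(x)`. -/
def needsPatch (X : Automaton α) (e : Exp α) (w : List α) : Set X.State :=
  {x | ¬ (X.langFrom x).leftQuotient w ≤ residual e.matches' (X.langFrom x)}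

/-- The construction `T_H` for `H = {e ≤ w}`, where `Z` is the automaton of `e`. -/
def TH (e : Exp α) (w : List α) (Z X : Automaton α) : Automaton α :=
  X.patch (Z.saturate w) w (X.needsPatch e w)

/-- The iterates `X, T_H(X), T_H(T_H(X)), …`. -/
def THIter (e : Exp α) (w : List α) (Z X : Automaton α) : ℕ → Automaton α
  | 0 => X
  | n + 1 => TH e w Z (THIter e w Z X n)

/-- The inclusion of the states of an iterate into those of the next one. -/
def THIncl (e : Exp α) (w : List α) (Z X : Automaton α) (n : ℕ)
    (x : (THIter e w Z X n).State) : (THIter e w Z X (n + 1)).State :=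
  Sum.inl x

/-- The identification of a state of `A n` with its image in `A (n + 1)`. -/
inductive ChainRel (A : ℕ → Automaton α) (incl : ∀ n, (A n).State → (A (n + 1)).State) :
    (Σ n, (A n).State) → (Σ n, (A n).State) → Prop
  | next (n : ℕ) (x : (A n).State) : ChainRel A incl ⟨n, x⟩ ⟨n + 1, incl n x⟩

/-- The limit (union) of a chain of automata `A 0 ⊑ A 1 ⊑ …`, each included in the next by
`incl n`. -/
def chainLimit (A : ℕ → Automaton α) (incl : ∀ n, (A n).State → (A (n + 1)).State) :
    Automaton α where
  State := Quot (ChainRel A incl)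
  step q a q' := ∃ (n : ℕ) (x x' : (A n).State), (A n).step x a x' ∧
    Quot.mk _ ⟨n, x⟩ = q ∧ Quot.mk _ ⟨n, x'⟩ = q'
  final := Quot.mk _ ⟨0, (A 0).final⟩
  start := Quot.mk _ ⟨0, (A 0).start⟩

/-- `T_H^*(X)`: the limit of the chain `X ⊑ T_H(X) ⊑ T_H(T_H(X)) ⊑ …`. -/
def THStar (e : Exp α) (w : List α) (Z X : Automaton α) : Automaton α :=
  chainLimit (THIter e w Z X) (THIncl e w Z X)

end Automaton

/-- A translation of regular expressions into finite automata for the same language. -/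
structure Translation (α : Type u) where
  aut : Exp α → Automaton α
  finite : ∀ g, Finite (aut g).State
  lang_eq : ∀ g, (aut g).lang = g.matches'

/-! ### Translations exist: Thompson's construction -/

namespace Automaton

variable {α : Type u}

/-- Transitions of the automaton of `e + f`. -/
inductive PlusStep (A B : Automaton α) :
    Bool ⊕ A.State ⊕ B.State → Option α → Bool ⊕ A.State ⊕ B.State → Prop
  | left {x a x'} : A.step x a x' → PlusStep A B (.inr (.inl x)) a (.inr (.inl x'))
  | right {x a x'} : B.step x a x' → PlusStep A B (.inr (.inr x)) a (.inr (.inr x'))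
  | enterLeft : PlusStep A B (.inl false) none (.inr (.inl A.start))
  | enterRight : PlusStep A B (.inl false) none (.inr (.inr B.start))
  | exitLeft : PlusStep A B (.inr (.inl A.final)) none (.inl true)
  | exitRight : PlusStep A B (.inr (.inr B.final)) none (.inl true)

/-- Transitions of the automaton of `e * f`. -/
inductive CompStep (A B : Automaton α) :
    A.State ⊕ B.State → Option α → A.State ⊕ B.State → Prop
  | left {x a x'} : A.step x a x' → CompStep A B (.inl x) a (.inl x')
  | right {x a x'} : B.step x a x' → CompStep A B (.inr x) a (.inr x')
  | mid : CompStep A B (.inl A.final) none (.inr B.start)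

/-- Transitions of the automaton of `e*`. -/
inductive StarStep (A : Automaton α) : Bool ⊕ A.State → Option α → Bool ⊕ A.State → Prop
  | inner {x a x'} : A.step x a x' → StarStep A (.inr x) a (.inr x')
  | skip : StarStep A (.inl false) none (.inl true)
  | enter : StarStep A (.inl false) none (.inr A.start)
  | again : StarStep A (.inr A.final) none (.inl false)

/-- Thompson's construction. -/
def thompson : Exp α → Automaton α
  | .zero => ⟨Bool, fun _ _ _ => False, true, false⟩
  | .epsilon => ⟨Bool, fun x b y => x = false ∧ b = none ∧ y = true, true, false⟩
  | .char a => ⟨Bool, fun x b y => x = false ∧ b = some a ∧ y = true, true, false⟩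
  | .plus e f =>
    ⟨_, PlusStep (thompson e) (thompson f), .inl true, .inl false⟩
  | .comp e f =>
    ⟨_, CompStep (thompson e) (thompson f), .inr (thompson f).final, .inl (thompson e).start⟩
  | .star e => ⟨_, StarStep (thompson e), .inl true, .inl false⟩

theorem thompson_finite (g : Exp α) : Finite (thompson g).State := by
  induction g with
  | zero | epsilon | char => exact inferInstanceAs (Finite Bool)
  | plus e f he hf =>
    exact inferInstanceAs (Finite (Bool ⊕ (thompson e).State ⊕ (thompson f).State))
  | comp e f he hf => exact inferInstanceAs (Finite ((thompson e).State ⊕ (thompson f).State))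
  | star e he => exact inferInstanceAs (Finite (Bool ⊕ (thompson e).State))

theorem trace_sound {X : Type} {step : X → Option α → X → Prop} (S : X → Language α)
    (h : ∀ x b y, step x b y → ∀ v ∈ S y, b.toList ++ v ∈ S x)
    {x y : X} {v : List α} (t : Trace step x v y) : ∀ v' ∈ S y, v ++ v' ∈ S x := by
  induction t with
  | refl => intro v' hv; exact hv
  | letter hs => intro v' hv; exact h _ _ _ hs v' hv
  | eps hs => intro v' hv; exact h _ _ _ hs v' hv
  | append _ _ h₁ h₂ => intro v' hv; rw [List.append_assoc]; exact h₁ _ (h₂ _ hv)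

theorem lang_le (X : Automaton α) (S : X.State → Language α) (hf : [] ∈ S X.final)
    (h : ∀ x b y, X.step x b y → ∀ v ∈ S y, b.toList ++ v ∈ S x) : X.lang ≤ S X.start := by
  intro v hv
  have := trace_sound S h hv [] hf
  rwa [List.append_nil] at this

theorem trace_map {X Y : Type} {step : X → Option α → X → Prop} {step' : Y → Option α → Y → Prop}
    (i : X → Y) (h : ∀ x b y, step x b y → step' (i x) b (i y))
    {x y : X} {v : List α} (t : Trace step x v y) : Trace step' (i x) v (i y) := by
  induction t with
  | refl => exact .refl _
  | letter hs => exact .letter (h _ _ _ hs)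
  | eps hs => exact .eps (h _ _ _ hs)
  | append _ _ h₁ h₂ => exact .append h₁ h₂

theorem langFrom_step (X : Automaton α) {x y : X.State} {b : Option α} (h : X.step x b y) :
    ∀ v ∈ X.langFrom y, b.toList ++ v ∈ X.langFrom x := by
  intro v hv
  cases b with
  | none => exact .append (.eps h) hv
  | some a => exact .append (.letter h) hv

theorem thompson_lang (g : Exp α) : (thompson g).lang = g.matches' := by
  induction g with
  | zero =>
    apply le_antisymm
    · refine lang_le (thompson (.zero : Exp α)) (fun x : Bool => cond x 1 0) ?_ ?_
      · exact rfl
      · intro x b y h; exact h.elim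
    · intro v hv; exact hv.elim
  | epsilon =>
    apply le_antisymm
    · refine lang_le (thompson (.epsilon : Exp α)) (fun _ => 1) rfl ?_
      rintro x b y ⟨_, rfl, _⟩ v hv
      exact hv
    · rintro v rfl
      exact .eps ⟨rfl, rfl, rfl⟩
  | char a =>
    apply le_antisymm
    · refine lang_le (thompson (.char a : Exp α))
        (fun x : Bool => cond x 1 {[a]}) rfl ?_
      rintro x b y ⟨rfl, rfl, rfl⟩ v rfl
      exact rfl
    · rintro v rfl
      exact .letter ⟨rfl, rfl, rfl⟩
  | plus e f he hf =>
    change (thompson (.plus e f)).lang = e.matches' + f.matches'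
    rw [← he, ← hf]
    apply le_antisymm
    · refine lang_le (thompson (.plus e f)) (Sum.elim
        (fun x : Bool => cond x 1 ((thompson e).lang + (thompson f).lang))
        (Sum.elim (thompson e).langFrom (thompson f).langFrom)) rfl ?_
      rintro x b y (h | h | _ | _ | _ | _) v hv
      · exact langFrom_step _ h v hv
      · exact langFrom_step _ h v hv
      · exact Or.inl hv
      · exact Or.inr hv
      · obtain rfl := hv; exact .refl _
      · obtain rfl := hv; exact .refl _
    · rintro v (hv | hv)
      · have := trace_map (step' := PlusStep (thompson e) (thompson f)) (fun x => .inr (.inl x))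
          (fun x b y => PlusStep.left) hv
        have := Trace.append (.append (.eps .enterLeft) this) (.eps .exitLeft)
        rwa [List.nil_append, List.append_nil] at this
      · have := trace_map (step' := PlusStep (thompson e) (thompson f)) (fun x => .inr (.inr x))
          (fun x b y => PlusStep.right) hv
        have := Trace.append (.append (.eps .enterRight) this) (.eps .exitRight)
        rwa [List.nil_append, List.append_nil] at this
  | comp e f he hf =>
    change (thompson (.comp e f)).lang = e.matches' * f.matches'
    rw [← he, ← hf]
    apply le_antisymm
    · refine lang_le (thompson (.comp e f)) (Sum.elim
        (fun x => (thompson e).langFrom x * (thompson f).lang) (thompson f).langFrom)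
        (.refl _) ?_
      rintro x b y (h | h | _) v hv
      · obtain ⟨v₁, h₁, v₂, h₂, rfl⟩ := hv
        exact ⟨_, langFrom_step _ h v₁ h₁, v₂, h₂, List.append_assoc _ _ _⟩
      · exact langFrom_step _ h v hv
      · exact ⟨[], .refl _, v, hv, rfl⟩
    · rintro _ ⟨v₁, h₁, v₂, h₂, rfl⟩
      have t₁ := trace_map (step' := CompStep (thompson e) (thompson f)) Sum.inl
          (fun x b y => CompStep.left) h₁
      have t₂ := trace_map (step' := CompStep (thompson e) (thompson f)) Sum.inr
          (fun x b y => CompStep.right) h₂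
      exact .append t₁ (.append (v := []) (.eps .mid) t₂)
  | star e he =>
    change (thompson (.star e)).lang = (e.matches')∗
    rw [← he]
    have hstar : ∀ v ∈ (thompson e).lang * (thompson e).lang∗, v ∈ (thompson e).lang∗ :=
      fun v hv => mul_kstar_le_kstar (a := (thompson e).lang) hv
    apply le_antisymm
    · refine lang_le (thompson (.star e)) (Sum.elim
        (fun x : Bool => cond x 1 ((thompson e).lang∗))
        (fun x => (thompson e).langFrom x * (thompson e).lang∗)) rfl ?_
      rintro x b y (h | _ | _ | _) v hv
      · obtain ⟨v₁, h₁, v₂, h₂, rfl⟩ := hv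
        exact ⟨_, langFrom_step _ h v₁ h₁, v₂, h₂, List.append_assoc _ _ _⟩
      · obtain rfl := hv
        exact ⟨[], rfl, by simp⟩
      · exact hstar v hv
      · exact ⟨[], .refl _, v, hv, rfl⟩
    · rintro _ ⟨L, rfl, hL⟩
      induction L with
      | nil => exact .eps .skip
      | cons v L ih =>
        have t := trace_map (step' := StarStep (thompson e)) Sum.inr
          (fun x b y => StarStep.inner) (hL v (by simp))
        have t' := Trace.append (.append (.eps .enter) t) (.eps .again)
        rw [List.nil_append, List.append_nil] at t'
        exact .append t' (ih fun y hy => hL y (by simp [hy]))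

end Automaton

/-- Thompson's construction is a translation. -/
instance {α : Type u} : Inhabited (Translation α) :=
  ⟨⟨Automaton.thompson, Automaton.thompson_finite, Automaton.thompson_lang⟩⟩

/-- The partial function `r_H` on expressions, for `H = {e ≤ w}`: it is defined on `g` if
`T_H^*` of the automaton of `g` is finite, and then returns the expression for its initial state. -/
noncomputable def rH {α : Type u} (T : Translation α) (e : Exp α) (w : List α) :
    Exp α →. Exp α :=
  fun g => ⟨Finite ((T.aut e).THStar e w (T.aut g)).State,
    fun _ => ((T.aut e).THStar e w (T.aut g)).toExp⟩

/-! ### Gödel numbering of regular expressions over a finite alphabet -/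

/-- The Gödel number of a regular expression. -/
noncomputable def code {α : Type u} [Finite α] : Exp α → ℕ
  | .zero => 0
  | .epsilon => 1
  | .char a => 2 + (Finite.equivFin α a : ℕ)
  | .plus e f => 2 + Nat.card α + (3 * Nat.pair (code e) (code f))
  | .comp e f => 2 + Nat.card α + (3 * Nat.pair (code e) (code f) + 1)
  | .star e => 2 + Nat.card α + (3 * code e + 2)

theorem code_injective {α : Type u} [Finite α] : Function.Injective (code (α := α)) := by
  intro e
  induction e with
  | zero => intro f h; cases f <;> simp only [code] at h <;> first | rfl | omega
  | epsilon => intro f h; cases f <;> simp only [code] at h <;> first | rfl | omega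
  | char a =>
    intro f h
    have ha := (Finite.equivFin α a).2
    cases f <;> simp only [code] at h <;> try omega
    have := (Finite.equivFin α).injective (Fin.ext (Nat.add_left_cancel h))
    rw [this]
  | plus e₁ e₂ h₁ h₂ =>
    intro f h
    cases f with
    | char b => have hb := (Finite.equivFin α b).2; simp only [code] at h; omega
    | plus f₁ f₂ =>
      simp only [code] at h
      have h' := Nat.pair_eq_pair.1 (show Nat.pair (code e₁) (code e₂) =
        Nat.pair (code f₁) (code f₂) by omega)
      rw [h₁ h'.1, h₂ h'.2]
    | _ => simp only [code] at h; omega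
  | comp e₁ e₂ h₁ h₂ =>
    intro f h
    cases f with
    | char b => have hb := (Finite.equivFin α b).2; simp only [code] at h; omega
    | comp f₁ f₂ =>
      simp only [code] at h
      have h' := Nat.pair_eq_pair.1 (show Nat.pair (code e₁) (code e₂) =
        Nat.pair (code f₁) (code f₂) by omega)
      rw [h₁ h'.1, h₂ h'.2]
    | _ => simp only [code] at h; omega
  | star e₁ h₁ =>
    intro f h
    cases f with
    | char b => have hb := (Finite.equivFin α b).2; simp only [code] at h; omega
    | star f₁ =>
      simp only [code] at h
      rw [h₁ (show code e₁ = code f₁ by omega)]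
    | _ => simp only [code] at h; omega

theorem code_surjective {α : Type u} [Finite α] : Function.Surjective (code (α := α)) := by
  intro n
  induction n using Nat.strong_induction_on with
  | _ n ih =>
    by_cases h0 : n = 0
    · exact ⟨.zero, by simp only [code, h0]⟩
    by_cases h1 : n = 1
    · exact ⟨.epsilon, by simp only [code, h1]⟩
    by_cases h2 : n - 2 < Nat.card α
    · refine ⟨.char ((Finite.equivFin α).symm ⟨n - 2, h2⟩), ?_⟩
      simp only [code, Equiv.apply_symm_apply]
      omega
    obtain ⟨k, hk⟩ : ∃ k, n = 2 + Nat.card α + k := ⟨n - 2 - Nat.card α, by omega⟩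
    have hl := Nat.unpair_left_le (k / 3)
    have hr := Nat.unpair_right_le (k / 3)
    obtain ⟨e, he⟩ := ih (k / 3).unpair.1 (by omega)
    obtain ⟨f, hf⟩ := ih (k / 3).unpair.2 (by omega)
    obtain ⟨g, hg⟩ := ih (k / 3) (by omega)
    have hp : Nat.pair (code e) (code f) = k / 3 := by rw [he, hf, Nat.pair_unpair]
    have h3 : k % 3 = 0 ∨ k % 3 = 1 ∨ k % 3 = 2 := by omega
    rcases h3 with h3 | h3 | h3
    · exact ⟨.plus e f, by simp only [code, hp]; omega⟩
    · exact ⟨.comp e f, by simp only [code, hp]; omega⟩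
    · exact ⟨.star g, by simp only [code, hg]; omega⟩

/-- Computability on regular expressions refers to their Gödel numbers. -/
noncomputable instance {α : Type u} [Finite α] : Denumerable (RegularExpression α) :=
  Denumerable.mk' (Equiv.ofBijective code ⟨code_injective, code_surjective⟩)

/-- The promise version of decidability, for a predicate on a domain `D` that need not be decidable
itself: some algorithm halts with the right answer on every input from `D`. -/
def DecidableOn {β : Type u} [Primcodable β] (D : Set β) (p : β → Prop) : Prop :=
  ∃ f : β →. Bool, Partrec f ∧ ∀ x ∈ D, ∃ b ∈ f x, b = true ↔ p x

end KAHyp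

namespace KAHyp
universe u

/-! ### Star of a finite matrix over a Kleene algebra. -/

section KleeneAlgebra

variable {K : Type*} [KleeneAlgebra K]

/-! The heart of the matter is that `T_H` never leaves the provable upper bound. Call an assignment
of terms to states a solution if it satisfies the inequalities of the transitions and has value at
least `1` at the final state. An expression whose language is accepted by a finite automaton is
provably below the initial value of every solution (`SolvedBy.le_start`, by subset construction and
the least-solution property of path matrices). Conversely the automaton of `h` has a solution with
initial value provably below `h`. Saturation and patching extend solutions without changing the
value at the old initial state (`SolvedBy.exists_saturate`, `SolvedBy.exists_patch`); this is where
`e ≤ w` is used. Hence everything accepted by an iterate of `T_H` on the automaton of `h` is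
provably below `h`.

If the limit is finite, some iterate has no state left to patch (`exists_needsPatch_eq_empty`), and
its language is then closed under the hypothesis (`hypClosed_lang`). So it contains the closure of
`h`. Equal closures therefore give `g ≤ h`, and symmetrically `h ≤ g`. Only the finiteness of the
limit is used, not the value of `r_H`.

For decidability the translation into automata need not be computable, so the algorithm does not run
the construction. It searches simultaneously for a derivation of `g = h` and for a certificate
against it: a finite list of expressions whose languages are closed under the hypothesis, one of
which contains `h` but misses a word of `g`. Every claim in a certificate is an inequation of plain
Kleene algebra, checked by bounded enumeration of derivations. Soundness (`HypClosed.ctxLE`) makes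
certificates reliable; the closed automaton of the first half makes them exist (`exists_separates`),
so the search halts on the domain of `r_H`. -/

theorem sum_le_of_le {ι : Type*} {s : Finset ι} {f : ι → K} {c : K} (h : ∀ i ∈ s, f i ≤ c) :
    ∑ i ∈ s, f i ≤ c := by
  classical
  induction s using Finset.induction_on with
  | empty => rw [Finset.sum_empty]; exact zero_le
  | insert i s hi ih =>
    rw [Finset.sum_insert hi]
    exact add_le (h i (by simp)) (ih fun j hj => h j (by simp [hj]))

theorem le_sum_of_mem {ι : Type*} {s : Finset ι} (f : ι → K) {i : ι} (hi : i ∈ s) :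
    f i ≤ ∑ i ∈ s, f i := by
  classical
  rw [← Finset.insert_erase hi, Finset.sum_insert (Finset.notMem_erase _ _), add_eq_sup]
  exact le_sup_left

/-- The matrix of paths whose intermediate vertices belong to `S`. -/
theorem exists_pathMatrix_through {Q : Type*} (M : Q → Q → K) (C : K → Prop)
    (hadd : ∀ a b, C a → C b → C (a + b)) (hmul : ∀ a b, C a → C b → C (a * b))
    (hstar : ∀ a, C a → C a∗) (hM : ∀ p q, C (M p q)) (S : Finset Q) :
    ∃ B : Q → Q → K, (∀ p r, M p r ≤ B p r) ∧ (∀ p, ∀ q ∈ S, ∀ r, M p q * B q r ≤ B p r) ∧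
      (∀ (t : Q → K) (r : Q) (c : K), (∀ p, M p r * c ≤ t p) →
        (∀ p, ∀ q ∈ S, M p q * t q ≤ t p) → ∀ p, B p r * c ≤ t p) ∧ ∀ p q, C (B p q) := by
  classical
  induction S using Finset.induction_on with
  | empty => exact ⟨M, fun _ _ => le_rfl, by simp, fun t r c h _ => h, hM⟩
  | insert k S _ ih =>
    obtain ⟨B, hB₁, hB₂, hB₃, hC⟩ := ih
    -- Kleene's recursion: a path through `insert k S` avoids `k`, or goes to `k`, loops there any
    -- number of times, and leaves. The predicate `C` is carried along so that entries can later be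
    -- recognised as regular languages.
    refine ⟨fun p q => B p q + B p k * ((B k k)∗ * B k q), ?_, ?_, ?_, ?_⟩
    · exact fun p r => (hB₁ p r).trans (le_add_of_nonneg_right zero_le)
    · intro p q hq r
      simp only [mul_add]
      rcases Finset.mem_insert.1 hq with rfl | hq
      · refine le_trans (add_le ?_ ?_) (le_add_of_nonneg_left (zero_le (a := B p r)))
        · calc M p q * B q r = M p q * (1 * B q r) := by rw [one_mul]
            _ ≤ B p q * ((B q q)∗ * B q r) := by
              gcongr
              · exact hB₁ _ _
              · exact one_le_kstar
        · calc M p q * (B q q * ((B q q)∗ * B q r)) = M p q * ((B q q * (B q q)∗) * B q r) := by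
                simp only [mul_assoc]
            _ ≤ B p q * ((B q q)∗ * B q r) := by
              gcongr
              · exact hB₁ _ _
              · exact mul_kstar_le_kstar
      · rw [← mul_assoc]
        exact add_le_add (hB₂ p q hq r) (mul_le_mul_left (hB₂ p q hq k) _)
    · intro t r c hr ht p
      have h₁ := hB₃ t r c hr fun p q hq => ht p q (by simp [hq])
      -- Minimality is used a second time, with target `k` and constant `t k`; this bounds the loops
      -- at `k` by star induction.
      have h₂ := hB₃ t k (t k) (fun p => ht p k (by simp)) fun p q hq => ht p q (by simp [hq])
      simp only [add_mul]
      refine add_le (h₁ p) ?_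
      calc B p k * ((B k k)∗ * B k r) * c = B p k * ((B k k)∗ * (B k r * c)) := by
            simp only [mul_assoc]
        _ ≤ B p k * ((B k k)∗ * t k) := by gcongr; exact h₁ k
        _ ≤ B p k * t k := by gcongr; exact kstar_mul_le_self (h₂ k)
        _ ≤ t p := h₂ p
    · exact fun p q => hadd _ _ (hC _ _) (hmul _ _ (hC _ _) (hmul _ _ (hstar _ (hC _ _)) (hC _ _)))

/-- Finite matrices over a Kleene algebra have a star. -/
theorem exists_pathMatrix {Q : Type*} [Finite Q] (M : Q → Q → K) (C : K → Prop) (hzero : C 0)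
    (hone : C 1) (hadd : ∀ a b, C a → C b → C (a + b)) (hmul : ∀ a b, C a → C b → C (a * b))
    (hstar : ∀ a, C a → C a∗) (hM : ∀ p q, C (M p q)) :
    ∃ B : Q → Q → K, (∀ p, 1 ≤ B p p) ∧ (∀ p q r, M p q * B q r ≤ B p r) ∧
      (∀ (t : Q → K) (r : Q) (c : K), c ≤ t r → (∀ p q, M p q * t q ≤ t p) →
        ∀ p, B p r * c ≤ t p) ∧ ∀ p q, C (B p q) := by
  classical
  have := Fintype.ofFinite Q
  obtain ⟨B, hB₁, hB₂, hB₃, hC⟩ :=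
    exists_pathMatrix_through M C hadd hmul hstar hM Finset.univ
  -- `B` collects the nonempty paths; the identity matrix adds the empty ones.
  refine ⟨fun p q => (if p = q then 1 else 0) + B p q, ?_, ?_, ?_, ?_⟩
  · intro p
    simp only [if_true]
    exact le_add_of_nonneg_right zero_le
  · intro p q r
    simp only [mul_add]
    refine le_trans (add_le ?_ (hB₂ p q (by simp) r)) (le_add_of_nonneg_left zero_le)
    split_ifs with h
    · rw [mul_one, ← h]; exact hB₁ p q
    · rw [mul_zero]; exact zero_le
  · intro t r c hr ht p
    simp only [add_mul]
    refine add_le ?_ (hB₃ t r c (fun p => ?_) (fun p q _ => ht p q) p)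
    · split_ifs with h
      · rw [one_mul, h]; exact hr
      · rw [zero_mul]; exact zero_le
    · exact le_trans (by gcongr) (ht p r)
  · intro p q
    refine hadd _ _ ?_ (hC p q)
    split_ifs <;> assumption

end KleeneAlgebra

/-! ### The Kleene algebra of expressions modulo provable equality -/

/-- Provable equality as a setoid. -/
def kaSetoid {α : Type u} (H : Set (Exp α × Exp α)) : Setoid (Exp α) :=
  ⟨KAEq H, .refl, .symm, .trans⟩

/-- Expressions modulo provable equality. -/
def KTerm {α : Type u} (H : Set (Exp α × Exp α)) : Type u := Quotient (kaSetoid H)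

namespace KTerm

variable {α : Type u} {H : Set (Exp α × Exp α)}

/-- The class of an expression modulo provable equality. -/
def mk (H : Set (Exp α × Exp α)) (g : Exp α) : KTerm H := Quotient.mk (kaSetoid H) g

theorem mk_eq_mk {g h : Exp α} : mk H g = mk H h ↔ KAEq H g h := Quotient.eq (r := kaSetoid H)

instance : Zero (KTerm H) := ⟨mk H 0⟩
instance : One (KTerm H) := ⟨mk H 1⟩
instance : Add (KTerm H) := ⟨Quotient.map₂ (· + ·) fun _ _ h _ _ h' => .add_congr h h'⟩
instance : Mul (KTerm H) := ⟨Quotient.map₂ (· * ·) fun _ _ h _ _ h' => .mul_congr h h'⟩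
instance : KStar (KTerm H) := ⟨Quotient.map RegularExpression.star fun _ _ h => .star_congr h⟩

instance : Semiring (KTerm H) where
  add_assoc := by
    rintro ⟨a⟩ ⟨b⟩ ⟨c⟩; exact (mk_eq_mk.2 (.add_assoc a b c)).symm
  zero_add := by
    rintro ⟨a⟩; exact mk_eq_mk.2 ((KAEq.add_comm 0 a).trans (.add_zero a))
  add_zero := by
    rintro ⟨a⟩; exact mk_eq_mk.2 (.add_zero a)
  add_comm := by
    rintro ⟨a⟩ ⟨b⟩; exact mk_eq_mk.2 (.add_comm a b)
  left_distrib := by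
    rintro ⟨a⟩ ⟨b⟩ ⟨c⟩; exact mk_eq_mk.2 (.mul_add a b c)
  right_distrib := by
    rintro ⟨a⟩ ⟨b⟩ ⟨c⟩; exact mk_eq_mk.2 (.add_mul a b c)
  zero_mul := by
    rintro ⟨a⟩; exact mk_eq_mk.2 (.zero_mul a)
  mul_zero := by
    rintro ⟨a⟩; exact mk_eq_mk.2 (.mul_zero a)
  mul_assoc := by
    rintro ⟨a⟩ ⟨b⟩ ⟨c⟩; exact (mk_eq_mk.2 (.mul_assoc a b c)).symm
  one_mul := by
    rintro ⟨a⟩; exact mk_eq_mk.2 (.one_mul a)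
  mul_one := by
    rintro ⟨a⟩; exact mk_eq_mk.2 (.mul_one a)
  nsmul := nsmulRec

instance : IdemSemiring (KTerm H) :=
  IdemSemiring.ofSemiring (by rintro ⟨a⟩; exact mk_eq_mk.2 (.add_idem a))

theorem mk_le_mk {g h : Exp α} : mk H g ≤ mk H h ↔ KALe H g h :=
  mk_eq_mk (H := H) (g := g + h) (h := h)

theorem le_of_add_eq {a b c : KTerm H} (h : c + a = b) : a ≤ b := by
  rw [← h, add_eq_sup]
  exact le_sup_right

instance : KleeneAlgebra (KTerm H) where
  one_le_kstar := by
    rintro ⟨a⟩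
    have h : (1 : KTerm H) + mk H a * (mk H a)∗ = (mk H a)∗ := mk_eq_mk.2 (.star_unfold_left a)
    exact le_of_add_eq ((add_comm _ _).trans h)
  mul_kstar_le_kstar := by
    rintro ⟨a⟩
    have h : (1 : KTerm H) + mk H a * (mk H a)∗ = (mk H a)∗ := mk_eq_mk.2 (.star_unfold_left a)
    exact le_of_add_eq h
  kstar_mul_le_kstar := by
    rintro ⟨a⟩
    have h : (1 : KTerm H) + (mk H a)∗ * mk H a = (mk H a)∗ := mk_eq_mk.2 (.star_unfold_right a)
    exact le_of_add_eq h
  mul_kstar_le_self := by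
    rintro ⟨a⟩ ⟨b⟩ h
    refine mk_le_mk.2 (KAEq.star_induct_right (mk_eq_mk.1 ?_))
    exact (add_le (le_refl (mk H b)) h : mk H b + mk H b * mk H a ≤ mk H b)
  kstar_mul_le_self := by
    rintro ⟨a⟩ ⟨b⟩ h
    refine mk_le_mk.2 (KAEq.star_induct_left (mk_eq_mk.1 ?_))
    exact (add_le (le_refl (mk H b)) h : mk H b + mk H a * mk H b ≤ mk H b)

end KTerm

theorem KALe.antisymm {α : Type u} {H : Set (Exp α × Exp α)} {g h : Exp α} (h₁ : KALe H g h)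
    (h₂ : KALe H h g) : KAEq H g h :=
  KTerm.mk_eq_mk.1 (le_antisymm (KTerm.mk_le_mk.2 h₁) (KTerm.mk_le_mk.2 h₂))

/-! ### Expressions against solutions of deterministic automata. -/

open KTerm in
/-- An expression whose language is accepted by a finite deterministic automaton is below the
initial value of each solution of the automaton. -/
theorem le_solution_of_dfa {α : Type u} [Finite α] {H : Set (Exp α × Exp α)} {P : Type*} [Finite P]
    (M : DFA α P) (t : P → KTerm H) (hacc : ∀ p ∈ M.accept, 1 ≤ t p)
    (hstep : ∀ p a, mk H (.char a) * t (M.step p a) ≤ t p) {g : Exp α}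
    (hg : g.matches' ≤ M.accepts) : mk H g ≤ t M.start := by
  classical
  have := Fintype.ofFinite P
  have := Fintype.ofFinite α
  obtain ⟨B, hB₁, hB₂, hB₃, -⟩ := exists_pathMatrix
    (fun p q => ∑ a : α with M.step p a = q, mk H (.char a)) (fun _ => True)
    trivial trivial (by simp) (by simp) (by simp) (by simp)
  have hchar (p : P) (a : α) (r : P) : mk H (.char a) * B (M.step p a) r ≤ B p r :=
    le_trans (by
      gcongr
      exact le_sum_of_mem (fun a => mk H (.char a)) (by simp)) (hB₂ p (M.step p a) r)
  -- Transitivity follows from minimality, since each column of `B` is itself a solution.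
  have hBB (p q r : P) : B p q * B q r ≤ B p r :=
    hB₃ (fun p => B p r) q (B q r) le_rfl (fun p q => hB₂ p q r) p
  -- Generalising over the starting state and summing over the states reached by words of `g` makes
  -- structural induction possible.
  have key (g : Exp α) (p : P) :
      mk H g ≤ ∑ q with ∃ v ∈ g.matches', M.evalFrom p v = q, B p q := by
    induction g generalizing p with
    | zero => exact (zero_le : (0 : KTerm H) ≤ _)
    | epsilon =>
      refine le_trans (hB₁ p) (le_sum_of_mem (B p) ?_)
      simp only [Finset.mem_filter, Finset.mem_univ, true_and]
      exact ⟨[], rfl, rfl⟩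
    | char a =>
      have h : mk H (.char a) ≤ B p (M.step p a) := by
        have := hchar p a (M.step p a)
        exact le_trans (by rw [mul_one]) ((mul_le_mul_right (hB₁ _) _).trans this)
      refine le_trans h (le_sum_of_mem (B p) ?_)
      simp only [Finset.mem_filter, Finset.mem_univ, true_and]
      exact ⟨[a], rfl, rfl⟩
    | plus g h hg hh =>
      refine add_le ((hg p).trans ?_) ((hh p).trans ?_)
      · refine sum_le_of_le fun q hq => le_sum_of_mem (B p) ?_
        simp only [Finset.mem_filter, Finset.mem_univ, true_and] at hq ⊢
        obtain ⟨v, hv, rfl⟩ := hq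
        exact ⟨v, Or.inl hv, rfl⟩
      · refine sum_le_of_le fun q hq => le_sum_of_mem (B p) ?_
        simp only [Finset.mem_filter, Finset.mem_univ, true_and] at hq ⊢
        obtain ⟨v, hv, rfl⟩ := hq
        exact ⟨v, Or.inr hv, rfl⟩
    | comp g h hg hh =>
      refine le_trans (mul_le_mul_left (hg p) (mk H h)) ?_
      rw [Finset.sum_mul]
      refine sum_le_of_le fun q hq => le_trans (mul_le_mul_right (hh q) _) ?_
      rw [Finset.mul_sum]
      refine sum_le_of_le fun r hr => (hBB p q r).trans (le_sum_of_mem (B p) ?_)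
      simp only [Finset.mem_filter, Finset.mem_univ, true_and] at hq hr ⊢
      obtain ⟨v, hv, rfl⟩ := hq
      obtain ⟨v', hv', rfl⟩ := hr
      exact ⟨v ++ v', ⟨v, hv, v', hv', rfl⟩, M.evalFrom_of_append p v v'⟩
    | star g hg =>
      change (mk H g)∗ ≤ _
      have hone : (1 : KTerm H) ≤
          ∑ q with ∃ v ∈ (RegularExpression.star g).matches', M.evalFrom p v = q, B p q := by
        refine le_trans (hB₁ p) (le_sum_of_mem (B p) ?_)
        simp only [Finset.mem_filter, Finset.mem_univ, true_and]
        exact ⟨[], one_le_kstar (a := g.matches') rfl, rfl⟩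
      -- Star induction on the right: the sum over the states reached by `g*` absorbs a further
      -- factor `g`.
      refine le_trans ?_ (mul_kstar_le_self (a := mk H g) ?_)
      · calc (mk H g)∗ = 1 * (mk H g)∗ := (one_mul _).symm
          _ ≤ _ := mul_le_mul_left hone _
      · rw [Finset.sum_mul]
        refine sum_le_of_le fun q hq => le_trans (mul_le_mul_right (hg q) _) ?_
        rw [Finset.mul_sum]
        refine sum_le_of_le fun r hr => (hBB p q r).trans (le_sum_of_mem (B p) ?_)
        simp only [Finset.mem_filter, Finset.mem_univ, true_and] at hq hr ⊢
        obtain ⟨v, hv, rfl⟩ := hq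
        obtain ⟨v', hv', rfl⟩ := hr
        exact ⟨v ++ v', kstar_mul_le_kstar (a := g.matches') ⟨v, hv, v', hv', rfl⟩,
          M.evalFrom_of_append p v v'⟩
  refine (key g M.start).trans (sum_le_of_le fun q hq => ?_)
  simp only [Finset.mem_filter, Finset.mem_univ, true_and] at hq
  obtain ⟨v, hv, hvq⟩ := hq
  have hq : q ∈ M.accept := hvq ▸ hg hv
  have := hB₃ t q 1 (hacc q hq) (fun p r => by
    rw [Finset.sum_mul]
    refine sum_le_of_le fun a ha => ?_
    simp only [Finset.mem_filter, Finset.mem_univ, true_and] at ha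
    rw [← ha]
    exact hstep p a) M.start
  rwa [mul_one] at this

/-! ### Solutions of automata -/

/-- Traces are built by arbitrary concatenation rather than letter by letter; in the `append` case
the cut falls into one of the two halves. -/
theorem Trace.split {α : Type u} {X : Type} {step : X → Option α → X → Prop} {x y : X}
    {l : List α} (t : Trace step x l y) :
    ∀ u v, l = u ++ v → ∃ z, Trace step x u z ∧ Trace step z v y := by
  induction t with
  | refl x =>
    intro u v h
    obtain ⟨rfl, rfl⟩ := List.append_eq_nil_iff.1 h.symm
    exact ⟨x, .refl x, .refl x⟩
  | @letter x x' a h =>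
    intro u v huv
    rcases u with _ | ⟨b, u⟩
    · obtain rfl : [a] = v := huv
      exact ⟨x, .refl x, .letter h⟩
    · obtain ⟨rfl, h'⟩ := List.cons_eq_cons.1 huv
      obtain ⟨rfl, rfl⟩ := List.append_eq_nil_iff.1 h'.symm
      exact ⟨x', .letter h, .refl x'⟩
  | @eps x x' h =>
    intro u v huv
    obtain ⟨rfl, rfl⟩ := List.append_eq_nil_iff.1 huv.symm
    exact ⟨x, .refl x, .eps h⟩
  | @append x x' x'' v₁ v₂ t₁ t₂ h₁ h₂ =>
    intro u v huv
    rcases List.append_eq_append_iff.1 huv with ⟨a, rfl, rfl⟩ | ⟨a, rfl, rfl⟩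
    · obtain ⟨z, hz, hz'⟩ := h₂ _ _ rfl
      exact ⟨z, .append t₁ hz, hz'⟩
    · obtain ⟨z, hz, hz'⟩ := h₁ _ _ rfl
      exact ⟨z, hz, .append hz' t₂⟩

namespace Automaton

variable {α : Type u}

theorem langFrom_append (X : Automaton α) {x y : X.State} {u v : List α} (h : Trace X.step x u y)
    (hv : v ∈ X.langFrom y) : u ++ v ∈ X.langFrom x := Trace.append h hv

/-- The interpretation of a transition label. -/
def labelExp : Option α → Exp α
  | none => 1
  | some a => .char a

/-- A solution to an automaton in Kleene algebra with hypotheses. -/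
structure SolvedBy (H : Set (Exp α × Exp α)) (X : Automaton α) (s : X.State → KTerm H) :
    Prop where
  final : 1 ≤ s X.final
  step : ∀ x b y, X.step x b y → KTerm.mk H (labelExp b) * s y ≤ s x

theorem mk_ofWord_append (H : Set (Exp α × Exp α)) (u v : List α) :
    KTerm.mk H (ofWord (u ++ v)) = KTerm.mk H (ofWord u) * KTerm.mk H (ofWord v) := by
  induction u with
  | nil => exact (one_mul _).symm
  | cons a u ih =>
    change KTerm.mk H (.char a) * KTerm.mk H (ofWord (u ++ v)) =
      KTerm.mk H (.char a) * KTerm.mk H (ofWord u) * _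
    rw [ih, mul_assoc]

theorem mk_ofWord_singleton (H : Set (Exp α × Exp α)) (a : α) :
    KTerm.mk H (ofWord [a]) = KTerm.mk H (.char a) :=
  mul_one (KTerm.mk H (.char a))

/-- Inequalities along transitions extend to traces. -/
theorem trace_le {H : Set (Exp α × Exp α)} {X : Type} {step : X → Option α → X → Prop}
    {s : X → KTerm H} (hs : ∀ x b y, step x b y → KTerm.mk H (labelExp b) * s y ≤ s x)
    {x y : X} {v : List α} (t : Trace step x v y) : KTerm.mk H (ofWord v) * s y ≤ s x := by
  induction t with
  | refl => exact (one_mul _).le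
  | @letter x y a h =>
    rw [mk_ofWord_singleton]
    exact hs _ _ _ h
  | eps h => exact hs _ _ _ h
  | append _ _ h₁ h₂ =>
    rw [mk_ofWord_append, mul_assoc]
    exact (mul_le_mul_right h₂ _).trans h₁

/-- An expression whose language is accepted by a finite automaton is provably below the
initial value of each solution of the automaton. -/
theorem SolvedBy.le_start [Finite α] {H : Set (Exp α × Exp α)} {X : Automaton α} [Finite X.State]
    {s : X.State → KTerm H} (hs : X.SolvedBy H s) {g : Exp α} (hg : g.matches' ≤ X.lang) :
    KTerm.mk H g ≤ s X.start := by
  classical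
  have := Fintype.ofFinite X.State
  -- Subset construction, with `ε`-closure built in because `Trace` on `[a]` allows `ε`-steps on
  -- both sides. A set of states receives the sum of the values of its members.
  let M : DFA α (Set X.State) :=
    ⟨fun S a => {q | ∃ p ∈ S, Trace X.step p [a] q}, {q | Trace X.step X.start [] q},
      {S | X.final ∈ S}⟩
  have heval (v : List α) : M.eval v = {q | Trace X.step X.start v q} := by
    induction v using List.reverseRecOn with
    | nil => rfl
    | append_singleton v a ih =>
      rw [DFA.eval_append_singleton, ih]
      ext q
      exact ⟨fun ⟨p, hp, hq⟩ => .append hp hq, fun h => h.split v [a] rfl⟩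
  have htrace {x y : X.State} {v : List α} (t : Trace X.step x v y) := trace_le hs.step t
  refine (le_solution_of_dfa M (fun S => ∑ q with q ∈ S, s q) ?_ ?_ (g := g) ?_).trans ?_
  · intro S hS
    exact hs.final.trans (le_sum_of_mem s (by simpa using (show X.final ∈ S from hS)))
  · intro S a
    rw [Finset.mul_sum]
    refine sum_le_of_le fun q hq => ?_
    simp only [Finset.mem_filter, Finset.mem_univ, true_and] at hq
    obtain ⟨p, hp, hpq⟩ := hq
    have h := htrace hpq
    rw [mk_ofWord_singleton] at h
    exact h.trans (le_sum_of_mem s (by simpa using hp))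
  · intro v hv
    change X.final ∈ M.eval v
    rw [heval]
    exact hg hv
  · refine sum_le_of_le fun q hq => ?_
    simp only [Finset.mem_filter, Finset.mem_univ, true_and] at hq
    exact (one_mul (s q)).ge.trans (htrace hq)

/-- Thompson's automaton of `g` has a solution with initial value below `g`. -/
theorem exists_solvedBy_thompson (H : Set (Exp α × Exp α)) (g : Exp α) :
    ∃ s, (thompson g).SolvedBy H s ∧ s (thompson g).start ≤ KTerm.mk H g := by
  induction g with
  | zero =>
    refine ⟨fun x : Bool => cond x 1 0, ⟨le_rfl, fun x b y h => h.elim⟩, zero_le⟩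
  | epsilon =>
    refine ⟨fun _ => 1, ⟨le_rfl, ?_⟩, le_rfl⟩
    rintro x b y ⟨_, rfl, _⟩
    exact (mul_one _).le
  | char a =>
    refine ⟨fun x : Bool => cond x 1 (KTerm.mk H (.char a)), ⟨le_rfl, ?_⟩, le_rfl⟩
    rintro x b y ⟨rfl, rfl, rfl⟩
    exact (mul_one _).le
  | plus e f he hf =>
    obtain ⟨s, hs, hs'⟩ := he
    obtain ⟨t, ht, ht'⟩ := hf
    refine ⟨Sum.elim (fun x : Bool => cond x 1 (KTerm.mk H e + KTerm.mk H f)) (Sum.elim s t),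
      ⟨le_rfl, ?_⟩, le_rfl⟩
    rintro x b y (h | h | _ | _ | _ | _)
    · exact hs.step _ _ _ h
    · exact ht.step _ _ _ h
    · exact (one_mul _).le.trans (hs'.trans (le_add_of_nonneg_right zero_le))
    · exact (one_mul _).le.trans (ht'.trans (le_add_of_nonneg_left zero_le))
    · exact (one_mul _).le.trans hs.final
    · exact (one_mul _).le.trans ht.final
  | comp e f he hf =>
    obtain ⟨s, hs, hs'⟩ := he
    obtain ⟨t, ht, ht'⟩ := hf
    refine ⟨Sum.elim (fun x => s x * KTerm.mk H f) t, ⟨ht.final, ?_⟩, mul_le_mul_left hs' _⟩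
    rintro x b y (h | h | _)
    · exact (mul_assoc _ _ _).ge.trans (mul_le_mul_left (hs.step _ _ _ h) _)
    · exact ht.step _ _ _ h
    · refine (one_mul _).le.trans (ht'.trans ?_)
      exact (one_mul _).ge.trans (mul_le_mul_left hs.final _)
  | star e he =>
    obtain ⟨s, hs, hs'⟩ := he
    refine ⟨Sum.elim (fun x : Bool => cond x 1 ((KTerm.mk H e)∗)) (fun x => s x * (KTerm.mk H e)∗),
      ⟨le_rfl, ?_⟩, le_rfl⟩
    rintro x b y (h | _ | _ | _)
    · exact (mul_assoc _ _ _).ge.trans (mul_le_mul_left (hs.step _ _ _ h) _)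
    · exact (one_mul _).le.trans one_le_kstar
    · exact (one_mul _).le.trans ((mul_le_mul_left hs' _).trans mul_kstar_le_kstar)
    · exact mul_le_mul_left hs.final _

end Automaton

/-- Completeness of Kleene algebra, in the presence of arbitrary hypotheses. -/
theorem kaLe_of_matches_le {α : Type u} [Finite α] (H : Set (Exp α × Exp α)) {g h : Exp α}
    (hgh : g.matches' ≤ h.matches') : KTerm.mk H g ≤ KTerm.mk H h := by
  -- Thompson's automaton has an explicit solution below `h`, and `g` is below every solution.
  obtain ⟨s, hs, hs'⟩ := Automaton.exists_solvedBy_thompson H h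
  have := Automaton.thompson_finite h
  exact (hs.le_start (hgh.trans (Automaton.thompson_lang h).ge)).trans hs'

/-! ### Kleene's theorem and solutions by regular expressions. -/

namespace Automaton

variable {α : Type u}

/-- Finite sums of regular languages are regular. -/
theorem exists_matches_eq_sum {ι : Type*} (s : Finset ι) (f : ι → Language α)
    (h : ∀ i ∈ s, ∃ g : Exp α, g.matches' = f i) : ∃ g : Exp α, g.matches' = ∑ i ∈ s, f i := by
  classical
  induction s using Finset.induction_on with
  | empty => exact ⟨0, rfl⟩
  | insert i s hi ih =>
    obtain ⟨g, hg⟩ := ih fun j hj => h j (by simp [hj])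
    obtain ⟨g', hg'⟩ := h i (by simp)
    exact ⟨g' + g, by rw [Finset.sum_insert hi, RegularExpression.matches'_add, hg, hg']⟩

/-- Kleene's theorem: the languages of the states of a finite automaton are regular. -/
theorem exists_matches_eq_langFrom [Finite α] (X : Automaton α) [Finite X.State] (x : X.State) :
    ∃ g : Exp α, g.matches' = X.langFrom x := by
  classical
  have := Fintype.ofFinite α
  let M : X.State → X.State → Language α :=
    fun x y => ∑ b : Option α with X.step x b y, (labelExp b).matches'
  obtain ⟨B, hB₁, hB₂, hB₃, hC⟩ := exists_pathMatrix M
    (fun L => ∃ g : Exp α, g.matches' = L) ⟨0, rfl⟩ ⟨1, rfl⟩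
    (by rintro _ _ ⟨g, rfl⟩ ⟨h, rfl⟩; exact ⟨g + h, rfl⟩)
    (by rintro _ _ ⟨g, rfl⟩ ⟨h, rfl⟩; exact ⟨g * h, rfl⟩)
    (by rintro _ ⟨g, rfl⟩; exact ⟨g.star, rfl⟩)
    (fun x y => exists_matches_eq_sum _ _ fun b _ => ⟨_, rfl⟩)
  have hlabel (b : Option α) : b.toList ∈ (labelExp b).matches' := by cases b <;> exact rfl
  have hlabel' (b : Option α) (v) (hv : v ∈ (labelExp b).matches') : v = b.toList := by
    cases b <;> exact hv
  obtain ⟨g, hg⟩ := hC x X.final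
  refine ⟨g, hg.trans (le_antisymm ?_ ?_)⟩
  -- In the Kleene algebra of languages, `X.langFrom` is a solution and so bounds the least one;
  -- conversely the accepted words lie in every solution.
  · have := hB₃ X.langFrom X.final 1 (by rintro _ rfl; exact .refl _) ?_ x
    · rwa [mul_one] at this
    · intro p q
      rw [Finset.sum_mul]
      refine sum_le_of_le fun b hb => ?_
      simp only [Finset.mem_filter, Finset.mem_univ, true_and] at hb
      rintro _ ⟨u, hu, v, hv, rfl⟩
      obtain rfl := hlabel' b u hu
      exact langFrom_step X hb v hv
  · exact lang_le ⟨X.State, X.step, X.final, x⟩ (fun x => B x X.final) (hB₁ _ rfl)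
      fun p b q h v hv => hB₂ p q X.final
        ⟨_, le_sum_of_mem (fun b : Option α => (labelExp b).matches') (by simpa using h) (hlabel b),
          v, hv, rfl⟩

/-- A finite automaton has a solution whose values have the languages of the states. -/
theorem exists_solvedBy [Finite α] (H : Set (Exp α × Exp α)) (X : Automaton α) [Finite X.State] :
    ∃ s : X.State → Exp α, (∀ x, (s x).matches' = X.langFrom x) ∧
      X.SolvedBy H fun x => KTerm.mk H (s x) := by
  -- The inequalities hold for the languages of the states, and completeness of Kleene algebra makes
  -- them provable.
  choose s hs using X.exists_matches_eq_langFrom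
  refine ⟨s, hs, ?_, ?_⟩
  · refine kaLe_of_matches_le H (g := 1) ?_
    rw [hs]
    rintro _ rfl
    exact .refl _
  · intro x b y h
    refine kaLe_of_matches_le H (g := labelExp b * s y) ?_
    rw [RegularExpression.matches'_mul, hs, hs]
    rintro _ ⟨u, hu, v, hv, rfl⟩
    cases b <;> obtain rfl := hu <;> exact langFrom_step X h v hv

end Automaton
-- Saturation, patching and iteration preserve solutions.
namespace Automaton

variable {α : Type u}

theorem mk_le_ofWord (e : Exp α) (w : List α) :
    KTerm.mk (linHyp e w) e ≤ KTerm.mk (linHyp e w) (ofWord w) :=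
  KTerm.mk_le_mk.2 (.hyp rfl)

/-- The `w`-saturation of `Z` has a solution with initial value below `w`, provided that `Z` has
one. -/
theorem SolvedBy.exists_saturate {H : Set (Exp α × Exp α)} {Z : Automaton α} [Finite Z.State]
    {s : Z.State → KTerm H} (hs : Z.SolvedBy H s) (w : List α)
    (hw : s Z.start ≤ KTerm.mk H (ofWord w)) :
    ∃ t, (Z.saturate w).SolvedBy H t ∧ t (Z.saturate w).start ≤ KTerm.mk H (ofWord w) := by
  classical
  have := Fintype.ofFinite Z.State
  set W := KTerm.mk H (ofWord w)
  -- `G` gathers all values that `W` absorbs on the right. Multiplying every value by `G∗` makes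
  -- room for the transitions leaving the final state.
  set G := ∑ z with W * s z ≤ W, s z
  have hG : W * G∗ ≤ W := by
    refine mul_kstar_le_self ?_
    rw [Finset.mul_sum]
    exact sum_le_of_le fun z hz => (Finset.mem_filter.1 hz).2
  have hfinal : G∗ ≤ s Z.final * G∗ := (one_mul _).ge.trans (mul_le_mul_left hs.final _)
  have hstart : s Z.start * G∗ ≤ W := (mul_le_mul_left hw _).trans hG
  -- Saturation is the least relation obeying the rules, so it suffices that the inequality itself,
  -- read as a transition relation, obeys them.
  have hsat : Z.SatRules w fun z b z' => KTerm.mk H (labelExp b) * (s z' * G∗) ≤ s z * G∗ := by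
    refine ⟨?_, ?_, ?_⟩
    · intro z b z' h
      exact (mul_assoc _ _ _).ge.trans (mul_le_mul_left (hs.step _ _ _ h) _)
    · intro z h
      -- The initial value is at most `W`, and `W` is at most the value at `z` because the final
      -- value is at least `1`.
      refine (one_mul _).le.trans (hstart.trans ?_)
      refine le_trans ?_ (trace_le (s := fun z => s z * G∗) (fun _ _ _ => id) h)
      exact (mul_one _).ge.trans (mul_le_mul_right (one_le_kstar.trans hfinal) _)
    · intro z h
      -- The trace from the start gives `W * s z ≤ W`, so `s z` is a summand of `G`, and `G * G∗ ≤
      -- G∗`.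
      have hz := (trace_le (s := fun z => s z * G∗) (fun _ _ _ => id) h).trans hstart
      have hz' : W * s z ≤ W :=
        (mul_le_mul_right ((mul_one _).ge.trans (mul_le_mul_right one_le_kstar _)) _).trans hz
      refine (one_mul _).le.trans (le_trans ?_ hfinal)
      exact (mul_le_mul_left (le_sum_of_mem s (by simpa using hz')) _).trans mul_kstar_le_kstar
  exact ⟨fun z => s z * G∗, ⟨one_le_kstar.trans hfinal, fun z b z' h => h _ hsat⟩, hstart⟩

/-- Patching preserves solutions. -/
theorem SolvedBy.exists_patch {H : Set (Exp α × Exp α)} {X Z : Automaton α} [Finite X.State]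
    {s : X.State → KTerm H} (hs : X.SolvedBy H s) {t : Z.State → KTerm H} (ht : Z.SolvedBy H t)
    {w : List α} (hw : t Z.start ≤ KTerm.mk H (ofWord w)) (P : Set X.State) :
    ∃ s' : X.State ⊕ (P × Z.State) → KTerm H,
      (X.patch Z w P).SolvedBy H s' ∧ ∀ x, s' (.inl x) = s x := by
  classical
  have := Fintype.ofFinite X.State
  -- A copied state is worth its value in `Z` times whatever can follow `w` at the patched state.
  -- Entering is sound because `t Z.start ≤ w` and `w * s y ≤ s p` for each `w`-successor `y`.
  refine ⟨Sum.elim s fun p => t p.2 * ∑ y with Trace X.step p.1 w y, s y, ⟨hs.final, ?_⟩,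
    fun x => rfl⟩
  rintro x b y (h | ⟨p, h⟩ | p | ⟨p, h⟩)
  · exact hs.step _ _ _ h
  · exact (mul_assoc _ _ _).ge.trans (mul_le_mul_left (ht.step _ _ _ h) _)
  · refine (one_mul _).le.trans ((mul_le_mul_left hw _).trans ?_)
    rw [Finset.mul_sum]
    exact sum_le_of_le fun y hy => trace_le hs.step (Finset.mem_filter.1 hy).2
  · refine (one_mul _).le.trans ?_
    refine le_trans ?_ ((one_mul _).ge.trans (mul_le_mul_left ht.final _))
    exact le_sum_of_mem s (by simpa using h)

theorem finite_THIter (e : Exp α) (w : List α) (Z X : Automaton α) [Finite Z.State]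
    [hX : Finite X.State] (n : ℕ) : Finite (THIter e w Z X n).State := by
  induction n with
  | zero => exact hX
  | succ n ih =>
    have : Finite (Z.saturate w).State := inferInstanceAs (Finite Z.State)
    exact inferInstanceAs (Finite ((THIter e w Z X n).State ⊕
      ((THIter e w Z X n).needsPatch e w × (Z.saturate w).State)))

/-- The iterates of `T_H` have solutions with the same initial value as the given one. -/
theorem SolvedBy.exists_THIter {e : Exp α} {w : List α} {H : Set (Exp α × Exp α)}
    {Z X : Automaton α} [Finite Z.State] [Finite X.State] {s : X.State → KTerm H}
    (hs : X.SolvedBy H s) {t : Z.State → KTerm H} (ht : Z.SolvedBy H t)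
    (hw : t Z.start ≤ KTerm.mk H (ofWord w)) (n : ℕ) :
    ∃ s', (THIter e w Z X n).SolvedBy H s' ∧ s' (THIter e w Z X n).start = s X.start := by
  induction n with
  | zero => exact ⟨s, hs, rfl⟩
  | succ n ih =>
    obtain ⟨s', hs', hstart⟩ := ih
    have := finite_THIter e w Z X n
    obtain ⟨t', ht', hw'⟩ := ht.exists_saturate w hw
    obtain ⟨s'', hs'', hs'''⟩ :=
      hs'.exists_patch ht' hw' ((THIter e w Z X n).needsPatch e w)
    exact ⟨s'', hs'', (hs''' _).trans hstart⟩

theorem lang_le_THIter (e : Exp α) (w : List α) (Z X : Automaton α) (n : ℕ) :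
    X.lang ≤ (THIter e w Z X n).lang := by
  induction n with
  | zero => exact le_rfl
  | succ n ih => exact ih.trans fun v hv => trace_map Sum.inl (fun _ _ _ => .old) hv

/-- The iterate in which a state appears. -/
def birth (e : Exp α) (w : List α) (Z X : Automaton α) : ∀ n, (THIter e w Z X n).State → ℕ
  | 0, _ => 0
  | n + 1, x => Sum.elim (birth e w Z X n) (fun _ => n + 1) x

/-- If `T_H^*(X)` is finite, then some iterate has no states that have to be patched. -/
theorem exists_needsPatch_eq_empty (e : Exp α) (w : List α) (Z X : Automaton α)
    (h : Finite (THStar e w Z X).State) : ∃ n, (THIter e w Z X n).needsPatch e w = ∅ := by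
  by_contra! hne
  choose p hp using hne
  -- If every stage has a state to patch, the initial states of the new copies are pairwise distinct
  -- in the limit, because the birth stage is invariant under the identifications.
  let c (n : ℕ) : (THStar e w Z X).State :=
    Quot.mk _ ⟨n + 1, (Sum.inr (⟨p n, hp n⟩, (Z.saturate w).start))⟩
  let b : (THStar e w Z X).State → ℕ :=
    Quot.lift (fun q => birth e w Z X q.1 q.2) (by rintro _ _ ⟨n, x⟩; rfl)
  have hb (n : ℕ) : b (c n) = n + 1 := rfl
  exact not_injective_infinite_finite c fun m n hmn => by
    have := congrArg b hmn
    rw [hb, hb] at this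
    exact Nat.succ_injective this

/-- `w⁻¹ l(x) ⊆ ⟦e⟧⁻¹ l(x)` holds at the states that do not have to be patched. -/
theorem mem_langFrom_of_needsPatch_eq_empty {X : Automaton α} {e : Exp α} {w : List α}
    (h : X.needsPatch e w = ∅) (x : X.State) {v : List α} (hv : w ++ v ∈ X.langFrom x)
    {y : List α} (hy : y ∈ e.matches') : y ++ v ∈ X.langFrom x := by
  have hx : x ∉ X.needsPatch e w := by rw [h]; exact Set.notMem_empty x
  exact not_not.1 hx (show v ∈ (X.langFrom x).leftQuotient w from hv) y hy

end Automaton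

/-! ### Languages closed under the hypothesis, and equality from equal closures. -/

theorem matches_ofWord {α : Type u} (w : List α) : (ofWord w).matches' = {w} := by
  induction w with
  | nil => rfl
  | cons a w ih =>
    change ({[a]} : Language α) * (ofWord w).matches' = _
    rw [ih]
    ext v
    exact ⟨fun ⟨_, h, _, h', hv⟩ => by obtain rfl := h; obtain rfl := h'; exact hv.symm,
      fun h => ⟨[a], rfl, w, rfl, h.symm⟩⟩

/-- Closedness of a language under the hypothesis `e ≤ w`. -/
def HypClosed {α : Type u} (e : Exp α) (w : List α) (L : Language α) : Prop :=
  ∀ u v, u ++ w ++ v ∈ L → ∀ y ∈ e.matches', u ++ y ++ v ∈ L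

theorem HypClosed.hypStep_eq {α : Type u} {e : Exp α} {w : List α} {L : Language α}
    (h : HypClosed e w L) : hypStep (linHyp e w) L = L := by
  ext x
  refine ⟨?_, Or.inl⟩
  rintro (hx | ⟨f, g, u, v, hfg, hg, y, hy, rfl⟩)
  · exact hx
  · obtain ⟨rfl, rfl⟩ : f = e ∧ g = ofWord w := Prod.ext_iff.1 hfg
    exact h u v (hg w (by rw [matches_ofWord]; exact rfl)) y hy

theorem HypClosed.semH_le {α : Type u} {e : Exp α} {w : List α} {L : Language α}
    (h : HypClosed e w L) {g : Exp α} (hg : g.matches' ≤ L) : semH (linHyp e w) g ≤ L :=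
  fun _ hx => hx L hg h.hypStep_eq

theorem matches_le_semH {α : Type u} (H : Set (Exp α × Exp α)) (g : Exp α) :
    g.matches' ≤ semH H g := (hypClosure_isLeast H g.matches').1.1

/-- Cut an accepting run on `u ++ w ++ v` after `u`: the state reached needs no patch, so there `w`
may be exchanged for any word of `e`. -/
theorem Automaton.hypClosed_lang {α : Type u} {X : Automaton α} {e : Exp α} {w : List α}
    (h : X.needsPatch e w = ∅) : HypClosed e w X.lang := by
  intro u v huv y hy
  rw [List.append_assoc] at huv ⊢
  obtain ⟨x, hx, hx'⟩ := Trace.split huv _ _ rfl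
  exact X.langFrom_append hx (mem_langFrom_of_needsPatch_eq_empty h x hx' hy)

/-- If `r_H` is defined on `h`, then the hypothesis closure of the language of `h` is accepted by a
finite automaton all of whose states satisfy the hypothesis, and which accepts only languages of
expressions provably below `h`. -/
theorem exists_closed_automaton {α : Type u} [Finite α] (T : Translation α) (e : Exp α)
    (w : List α) {h : Exp α} (hh : (rH T e w h).Dom) :
    ∃ X : Automaton α, Finite X.State ∧ X.needsPatch e w = ∅ ∧ h.matches' ≤ X.lang ∧
      ∀ g : Exp α, g.matches' ≤ X.lang → KALe (linHyp e w) g h := by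
  have := T.finite e
  have := T.finite h
  obtain ⟨n, hn⟩ := Automaton.exists_needsPatch_eq_empty e w (T.aut e) (T.aut h) hh
  obtain ⟨s, hs, hs'⟩ := (T.aut h).exists_solvedBy (linHyp e w)
  obtain ⟨t, ht, ht'⟩ := (T.aut e).exists_solvedBy (linHyp e w)
  have hfin := Automaton.finite_THIter e w (T.aut e) (T.aut h) n
  -- The hypothesis enters here: the initial value for the automaton of `e` is provably below `e`,
  -- hence below `w`.
  have hte : KTerm.mk (linHyp e w) (t (T.aut e).start) ≤ KTerm.mk (linHyp e w) (ofWord w) :=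
    (kaLe_of_matches_le _ ((ht _).trans (T.lang_eq e)).le).trans (Automaton.mk_le_ofWord e w)
  obtain ⟨s', hs'', hstart⟩ := hs'.exists_THIter (e := e) ht' hte n
  refine ⟨_, hfin, hn, (T.lang_eq h).ge.trans (Automaton.lang_le_THIter e w _ _ n), ?_⟩
  intro g hg
  refine KTerm.mk_le_mk.1 ((hs''.le_start hg).trans (hstart.le.trans ?_))
  exact kaLe_of_matches_le _ ((hs _).trans (T.lang_eq h)).le

/-- The closed automaton `Y` of `h` contains the closure of `h`, hence that of `g`, hence `g`; and
whatever it contains is provably below `h`. The same holds with the roles exchanged. -/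
theorem kaEq_of_semH_eq {α : Type u} [Finite α] (T : Translation α) (e : Exp α) (w : List α)
    {g h : Exp α} (hg : (rH T e w g).Dom) (hh : (rH T e w h).Dom)
    (hgh : semH (linHyp e w) g = semH (linHyp e w) h) : KAEq (linHyp e w) g h := by
  obtain ⟨X, -, hX, hXg, hXle⟩ := exists_closed_automaton T e w hg
  obtain ⟨Y, -, hY, hYh, hYle⟩ := exists_closed_automaton T e w hh
  refine KALe.antisymm (hYle g ?_) (hXle h ?_)
  · exact (matches_le_semH _ g).trans (hgh.le.trans ((Y.hypClosed_lang hY).semH_le hYh))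
  · exact (matches_le_semH _ h).trans (hgh.ge.trans ((X.hypClosed_lang hX).semH_le hXg))

/-! ### Soundness -/

/-- `A` and `B` occur in the same contexts inside `L`. -/
def CtxLE {α : Type u} (L A B : Language α) : Prop :=
  ∀ u v, (∀ y ∈ B, u ++ y ++ v ∈ L) → ∀ y ∈ A, u ++ y ++ v ∈ L

namespace CtxLE

variable {α : Type u} {L A A' B B' : Language α}

theorem of_le (h : A ≤ B) : CtxLE L A B := fun _ _ hB y hy => hB y (h hy)

theorem trans {C : Language α} (h₁ : CtxLE L A B) (h₂ : CtxLE L B C) : CtxLE L A C :=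
  fun u v hC => h₁ u v (h₂ u v hC)

theorem add (h : CtxLE L A B) (h' : CtxLE L A' B) : CtxLE L (A + A') B := by
  rintro u v hB y (hy | hy)
  exacts [h u v hB y hy, h' u v hB y hy]

/-- Two-sided contexts make this work: one factor is exchanged at a time while the other is absorbed
into the context. -/
theorem mul (h : CtxLE L A B) (h' : CtxLE L A' B') : CtxLE L (A * A') (B * B') := by
  rintro u v hB _ ⟨x, hx, y, hy, rfl⟩
  have := h u (y ++ v) (fun x hx => ?_) x hx
  · simpa using this
  · have := h' (u ++ x) v (fun y hy => by simpa using hB _ ⟨x, hx, y, hy, rfl⟩) y hy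
    simpa using this

theorem pow (h : CtxLE L A B) (n : ℕ) : CtxLE L (A ^ n) (B ^ n) := by
  induction n with
  | zero => exact of_le le_rfl
  | succ n ih => rw [pow_succ, pow_succ]; exact ih.mul h

theorem exists_mem_pow_of_mem_kstar {x : List α} (hx : x ∈ A∗) : ∃ n, x ∈ A ^ n := by
  rwa [Language.kstar_eq_iSup_pow, Language.mem_iSup] at hx

theorem of_pow (h : ∀ n, CtxLE L (A ^ n * B) B') : CtxLE L (A∗ * B) B' := by
  rintro u v hB _ ⟨x, hx, y, hy, rfl⟩
  obtain ⟨n, hn⟩ := exists_mem_pow_of_mem_kstar hx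
  exact h n u v hB _ ⟨x, hn, y, hy, rfl⟩

theorem of_pow' (h : ∀ n, CtxLE L (B * A ^ n) B') : CtxLE L (B * A∗) B' := by
  rintro u v hB _ ⟨y, hy, x, hx, rfl⟩
  obtain ⟨n, hn⟩ := exists_mem_pow_of_mem_kstar hx
  exact h n u v hB _ ⟨y, hy, x, hn, rfl⟩

theorem star (h : CtxLE L A B) : CtxLE L A∗ B∗ := by
  have := of_pow (L := L) (A := A) (B := 1) (B' := B∗) fun n => by
    rw [mul_one]
    refine (h.pow n).trans (of_le ?_)
    exact pow_le_kstar
  rwa [mul_one] at this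

end CtxLE

/-- Provable equality preserves the contexts inside each closed language. -/
theorem HypClosed.ctxLE {α : Type u} {e : Exp α} {w : List α} {L : Language α}
    (hL : HypClosed e w L) {g h : Exp α} (d : KAEq (linHyp e w) g h) :
    CtxLE L g.matches' h.matches' ∧ CtxLE L h.matches' g.matches' := by
  have of_eq {A B : Language α} (h : A = B) : CtxLE L A B ∧ CtxLE L B A :=
    ⟨.of_le h.le, .of_le h.ge⟩
  induction d with
  | refl => exact of_eq rfl
  | symm _ ih => exact ih.symm
  | trans _ _ h₁ h₂ => exact ⟨h₁.1.trans h₂.1, h₂.2.trans h₁.2⟩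
  | add_congr _ _ h₁ h₂ =>
    exact ⟨(h₁.1.trans (.of_le le_sup_left)).add (h₂.1.trans (.of_le le_sup_right)),
      (h₁.2.trans (.of_le le_sup_left)).add (h₂.2.trans (.of_le le_sup_right))⟩
  | mul_congr _ _ h₁ h₂ => exact ⟨h₁.1.mul h₂.1, h₁.2.mul h₂.2⟩
  | star_congr _ h => exact ⟨h.1.star, h.2.star⟩
  | add_zero e => exact of_eq (_root_.add_zero e.matches')
  | add_idem e => exact of_eq (_root_.add_idem e.matches')
  | add_comm e f => exact of_eq (_root_.add_comm e.matches' f.matches')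
  | add_assoc e f g => exact of_eq (_root_.add_assoc e.matches' f.matches' g.matches').symm
  | mul_zero e => exact of_eq (MulZeroClass.mul_zero e.matches')
  | zero_mul e => exact of_eq (MulZeroClass.zero_mul e.matches')
  | mul_one e => exact of_eq (_root_.mul_one e.matches')
  | one_mul e => exact of_eq (_root_.one_mul e.matches')
  | mul_assoc e f g => exact of_eq (_root_.mul_assoc e.matches' f.matches' g.matches').symm
  | mul_add e f g => exact of_eq (_root_.mul_add e.matches' f.matches' g.matches')
  | add_mul e f g => exact of_eq (_root_.add_mul e.matches' f.matches' g.matches')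
  | star_unfold_left e => exact of_eq (Language.one_add_self_mul_kstar_eq_kstar e.matches')
  | star_unfold_right e => exact of_eq (Language.one_add_kstar_mul_self_eq_kstar e.matches')
  | @star_induct_left e f g _ ih =>
    have hfg : CtxLE L (f.matches' * g.matches') g.matches' :=
      (CtxLE.of_le (le_sup_right.trans le_sup_left)).trans ih.1
    have heg : CtxLE L e.matches' g.matches' :=
      (CtxLE.of_le (le_sup_left.trans le_sup_left)).trans ih.1
    refine ⟨CtxLE.add (CtxLE.of_pow fun n => ?_) (.of_le le_rfl), .of_le le_sup_right⟩
    -- A star is the union of its powers, so it is enough to absorb `f` into `g` from the left, `n`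
    -- times.
    refine CtxLE.trans (B := f.matches' ^ n * g.matches') ((CtxLE.of_le le_rfl).mul heg) ?_
    induction n with
    | zero => exact .of_le (by simp)
    | succ n ihn =>
      rw [pow_succ, _root_.mul_assoc]
      exact ((CtxLE.of_le le_rfl).mul hfg).trans ihn
  | @star_induct_right e f g _ ih =>
    have hfg : CtxLE L (f.matches' * g.matches') f.matches' :=
      (CtxLE.of_le (le_sup_right.trans le_sup_left)).trans ih.1
    have heg : CtxLE L e.matches' f.matches' :=
      (CtxLE.of_le (le_sup_left.trans le_sup_left)).trans ih.1
    refine ⟨CtxLE.add (CtxLE.of_pow' fun n => ?_) (.of_le le_rfl), .of_le le_sup_right⟩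
    refine CtxLE.trans (B := f.matches' * g.matches' ^ n) (heg.mul (CtxLE.of_le le_rfl)) ?_
    induction n with
    | zero => exact .of_le (by simp)
    | succ n ihn =>
      rw [pow_succ', ← _root_.mul_assoc]
      exact (hfg.mul (CtxLE.of_le le_rfl)).trans ihn
  | @hyp f g hfg =>
    obtain ⟨rfl, rfl⟩ : f = e ∧ g = ofWord w := Prod.ext_iff.1 hfg
    refine ⟨CtxLE.add (fun u v hB y hy => ?_) (.of_le le_rfl), .of_le le_sup_right⟩
    exact hL u v (hB w (by rw [matches_ofWord]; exact rfl)) y hy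

/-- This is soundness in the empty context. -/
theorem HypClosed.matches_le {α : Type u} {e : Exp α} {w : List α} {L : Language α}
    (hL : HypClosed e w L) {g h : Exp α} (d : KAEq (linHyp e w) g h) (hh : h.matches' ≤ L) :
    g.matches' ≤ L := fun y hy => by
  rw [← List.append_nil y]
  exact (hL.ctxLE d).1 [] [] (fun y hy => (List.append_nil y).symm ▸ hh hy) y hy

/-! ### Primitive recursive operations on regular expressions -/

section Primrec

variable {β γ : Type*} [Primcodable β] [Primcodable γ]

theorem primrecPred_mem {f : β → γ} {l : β → List γ} (hf : Primrec f) (hl : Primrec l) :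
    PrimrecPred fun x => f x ∈ l x :=
  (Primrec.eq.exists_mem_list.comp hl hf).of_eq fun x => by simp

theorem primrecPred_forall_mem {l : β → List γ} {p : β → γ → Prop} (hl : Primrec l)
    (hp : PrimrecRel p) : PrimrecPred fun x => ∀ y ∈ l x, p x y :=
  PrimrecRel.comp (PrimrecRel.forall_mem_list (R := fun y x => p x y)
    (PrimrecRel.comp hp Primrec.snd Primrec.fst)) hl Primrec.id

theorem primrecPred_exists_mem {l : β → List γ} {p : β → γ → Prop} (hl : Primrec l)
    (hp : PrimrecRel p) : PrimrecPred fun x => ∃ y ∈ l x, p x y :=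
  PrimrecRel.comp (PrimrecRel.exists_mem_list (R := fun y x => p x y)
    (PrimrecRel.comp hp Primrec.snd Primrec.fst)) hl Primrec.id

/-- The list of functions is fixed, so induction on it reduces selection by index to finitely many
case distinctions. It is applied to the finite list of inference rules. -/
theorem primrec_getD_apply (d : γ) (fs : List (β → γ)) (h : ∀ f ∈ fs, Primrec f) :
    Primrec fun q : ℕ × β => fs.getD q.1 (fun _ => d) q.2 := by
  induction fs with
  | nil => exact Primrec.const d
  | cons f fs ih =>
    have h₁ : Primrec fun q : ℕ × β => f q.2 := (h f (by simp)).comp Primrec.snd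
    have h₂ : Primrec₂ fun (q : ℕ × β) (n : ℕ) => fs.getD n (fun _ => d) q.2 :=
      (ih fun f hf => h f (by simp [hf])).comp
        (Primrec.pair Primrec.snd (Primrec.snd.comp Primrec.fst))
    refine (Primrec.nat_casesOn Primrec.fst h₁ h₂).of_eq ?_
    rintro ⟨_ | n, x⟩ <;> rfl

variable {α : Type u} [Finite α] {f g : β → Exp α}

theorem primrec_add (hf : Primrec f) (hg : Primrec g) : Primrec fun x => f x + g x := by
  refine Primrec.encode_iff.1 ?_
  change Primrec fun x =>
    2 + Nat.card α + (3 * Nat.pair (Encodable.encode (f x)) (Encodable.encode (g x)))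
  exact Primrec.nat_add.comp (.const _) (Primrec.nat_mul.comp (.const 3)
    (Primrec₂.natPair.comp (Primrec.encode.comp hf) (Primrec.encode.comp hg)))

theorem primrec_mul (hf : Primrec f) (hg : Primrec g) : Primrec fun x => f x * g x := by
  refine Primrec.encode_iff.1 ?_
  change Primrec fun x =>
    2 + Nat.card α + (3 * Nat.pair (Encodable.encode (f x)) (Encodable.encode (g x)) + 1)
  exact Primrec.nat_add.comp (.const _) (Primrec.succ.comp (Primrec.nat_mul.comp (.const 3)
    (Primrec₂.natPair.comp (Primrec.encode.comp hf) (Primrec.encode.comp hg))))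

theorem primrec_star (hf : Primrec f) : Primrec fun x => (f x).star := by
  refine Primrec.encode_iff.1 ?_
  change Primrec fun x => 2 + Nat.card α + (3 * Encodable.encode (f x) + 2)
  exact Primrec.nat_add.comp (.const _) (Primrec.nat_add.comp (Primrec.nat_mul.comp (.const 3)
    (Primrec.encode.comp hf)) (.const 2))

end Primrec

/-! ### Enumeration of the provable equations -/

section Enumeration

variable {α : Type u}

/-- A rule with two premises and a conclusion. -/
abbrev Inference (α : Type u) : Type u := (Exp α × Exp α) × (Exp α × Exp α) × (Exp α × Exp α)

/-- An inference whose only premise is the trivial one. -/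
abbrev Inference.ax (g h : Exp α) : Inference α := ((0, 0), (0, 0), (g, h))

/-- An inference with one premise. -/
abbrev Inference.unary (p q : Exp α × Exp α) : Inference α := (p, (0, 0), q)

open Inference in
/-- The rules of Kleene algebra with the hypothesis `e ≤ w`. -/
def rules (e : Exp α) (w : List α) : List (Exp α × Exp α × Exp α × Exp α → Inference α) :=
  [fun p => ax p.1 p.1,
   fun p => unary (p.1, p.2.1) (p.2.1, p.1),
   fun p => ((p.1, p.2.1), (p.2.1, p.2.2.1), (p.1, p.2.2.1)),
   fun p => ((p.1, p.2.1), (p.2.2.1, p.2.2.2), (p.1 + p.2.2.1, p.2.1 + p.2.2.2)),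
   fun p => ((p.1, p.2.1), (p.2.2.1, p.2.2.2), (p.1 * p.2.2.1, p.2.1 * p.2.2.2)),
   fun p => unary (p.1, p.2.1) (p.1.star, p.2.1.star),
   fun p => ax (p.1 + 0) p.1,
   fun p => ax (p.1 + p.1) p.1,
   fun p => ax (p.1 + p.2.1) (p.2.1 + p.1),
   fun p => ax (p.1 + (p.2.1 + p.2.2.1)) ((p.1 + p.2.1) + p.2.2.1),
   fun p => ax (p.1 * 0) 0,
   fun p => ax (0 * p.1) 0,
   fun p => ax (p.1 * 1) p.1,
   fun p => ax (1 * p.1) p.1,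
   fun p => ax (p.1 * (p.2.1 * p.2.2.1)) ((p.1 * p.2.1) * p.2.2.1),
   fun p => ax (p.1 * (p.2.1 + p.2.2.1)) (p.1 * p.2.1 + p.1 * p.2.2.1),
   fun p => ax ((p.1 + p.2.1) * p.2.2.1) (p.1 * p.2.2.1 + p.2.1 * p.2.2.1),
   fun p => ax (1 + p.1 * p.1.star) p.1.star,
   fun p => ax (1 + p.1.star * p.1) p.1.star,
   fun p => unary ((p.1 + p.2.1 * p.2.2.1) + p.2.2.1, p.2.2.1)
     (p.2.1.star * p.1 + p.2.2.1, p.2.2.1),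
   fun p => unary ((p.1 + p.2.1 * p.2.2.1) + p.2.1, p.2.1)
     (p.1 * p.2.2.1.star + p.2.1, p.2.1),
   fun _ => ax (e + ofWord w) (ofWord w)]

theorem rules_sound (e : Exp α) (w : List α) : ∀ f ∈ rules e w, ∀ p,
    KAEq (linHyp e w) (f p).1.1 (f p).1.2 → KAEq (linHyp e w) (f p).2.1.1 (f p).2.1.2 →
    KAEq (linHyp e w) (f p).2.2.1 (f p).2.2.2 := by
  unfold rules
  simp only [List.forall_mem_cons]
  exact ⟨fun _ _ _ => .refl _, fun _ h _ => .symm h, fun _ h h' => .trans h h',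
    fun _ h h' => .add_congr h h', fun _ h h' => .mul_congr h h', fun _ h _ => .star_congr h,
    fun _ _ _ => .add_zero _, fun _ _ _ => .add_idem _, fun _ _ _ => .add_comm _ _,
    fun _ _ _ => .add_assoc _ _ _, fun _ _ _ => .mul_zero _, fun _ _ _ => .zero_mul _,
    fun _ _ _ => .mul_one _, fun _ _ _ => .one_mul _, fun _ _ _ => .mul_assoc _ _ _,
    fun _ _ _ => .mul_add _ _ _, fun _ _ _ => .add_mul _ _ _,
    fun _ _ _ => .star_unfold_left _, fun _ _ _ => .star_unfold_right _,
    fun _ h _ => .star_induct_left h, fun _ h _ => .star_induct_right h,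
    fun _ _ _ => .hyp rfl, fun _ h => absurd h List.not_mem_nil⟩

variable [Finite α]

theorem primrec_of_mem_rules (e : Exp α) (w : List α) : ∀ f ∈ rules e w, Primrec f := by
  have ha : Primrec fun p : Exp α × Exp α × Exp α × Exp α => p.1 := Primrec.fst
  have hb : Primrec fun p : Exp α × Exp α × Exp α × Exp α => p.2.1 :=
    Primrec.fst.comp Primrec.snd
  have hc : Primrec fun p : Exp α × Exp α × Exp α × Exp α => p.2.2.1 :=
    Primrec.fst.comp (Primrec.snd.comp Primrec.snd)
  have hd : Primrec fun p : Exp α × Exp α × Exp α × Exp α => p.2.2.2 :=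
    Primrec.snd.comp (Primrec.snd.comp Primrec.snd)
  unfold rules
  simp only [List.forall_mem_cons]
  refine ⟨?_, ?_, ?_, ?_, ?_, ?_, ?_, ?_, ?_, ?_, ?_, ?_, ?_, ?_, ?_, ?_, ?_, ?_, ?_, ?_, ?_, ?_,
    fun _ h => absurd h List.not_mem_nil⟩
  all_goals
    with_reducible
      repeat' first
        | exact ha
        | exact hb
        | exact hc
        | exact hd
        | exact Primrec.const _
        | apply Primrec.pair
        | apply primrec_add
        | apply primrec_mul
        | apply primrec_star

/-- The `d`-th instance of the rules. -/
noncomputable def inference (e : Exp α) (w : List α) (d : ℕ) : Inference α :=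
  (rules e w).getD (Denumerable.ofNat (ℕ × Exp α × Exp α × Exp α × Exp α) d).1
    (fun _ => Inference.ax 0 0) (Denumerable.ofNat (ℕ × Exp α × Exp α × Exp α × Exp α) d).2

theorem inference_sound (e : Exp α) (w : List α) (d : ℕ)
    (h₁ : KAEq (linHyp e w) (inference e w d).1.1 (inference e w d).1.2)
    (h₂ : KAEq (linHyp e w) (inference e w d).2.1.1 (inference e w d).2.1.2) :
    KAEq (linHyp e w) (inference e w d).2.2.1 (inference e w d).2.2.2 := by
  unfold inference at h₁ h₂ ⊢
  generalize Denumerable.ofNat (ℕ × Exp α × Exp α × Exp α × Exp α) d = q at h₁ h₂ ⊢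
  by_cases hq : q.1 < (rules e w).length
  · rw [List.getD_eq_getElem _ _ hq] at h₁ h₂ ⊢
    exact rules_sound e w _ (List.getElem_mem hq) _ h₁ h₂
  -- An index beyond the list yields the default inference, which concludes `0 = 0`.
  · rw [List.getD_eq_default _ _ (not_lt.1 hq)]
    exact .refl _

open Classical in
/-- The equations that are derived by the first `n` inferences. -/
noncomputable def derived (e : Exp α) (w : List α) : ℕ → List (Exp α × Exp α)
  -- The seed is the dummy premise of the inferences with fewer than two premises.
  | 0 => [(0, 0)]
  | n + 1 =>
    -- Since only the first component of `n` is read, each inference is tried again at arbitrarily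
    -- late stages, when its premises may have become available.
    if (inference e w n.unpair.1).1 ∈ derived e w n ∧
        (inference e w n.unpair.1).2.1 ∈ derived e w n then
      (inference e w n.unpair.1).2.2 :: derived e w n
    else derived e w n

theorem primrec_derived (e : Exp α) (w : List α) : Primrec (derived e w) := by
  classical
  have hi : Primrec fun q : ℕ × List (Exp α × Exp α) => inference e w q.1.unpair.1 :=
    (primrec_getD_apply (Inference.ax 0 0) (rules e w) (primrec_of_mem_rules e w)).comp
      ((Primrec.ofNat _).comp (Primrec.fst.comp (Primrec.unpair.comp Primrec.fst)))
  have hstep : Primrec₂ fun (n : ℕ) (l : List (Exp α × Exp α)) =>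
      if (inference e w n.unpair.1).1 ∈ l ∧ (inference e w n.unpair.1).2.1 ∈ l then
        (inference e w n.unpair.1).2.2 :: l else l :=
    Primrec.ite ((primrecPred_mem (Primrec.fst.comp hi) Primrec.snd).and
      (primrecPred_mem (Primrec.fst.comp (Primrec.snd.comp hi)) Primrec.snd))
      (Primrec.list_cons.comp (Primrec.snd.comp (Primrec.snd.comp hi)) Primrec.snd) Primrec.snd
  refine (Primrec.nat_rec₁ [(0, 0)] hstep).of_eq fun n => ?_
  induction n with
  | zero => rfl
  | succ n ih => rw [derived, ← ih]

theorem derived_mono (e : Exp α) (w : List α) {m n : ℕ} (h : m ≤ n) :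
    derived e w m ⊆ derived e w n := by
  induction n, h using Nat.le_induction with
  | base => exact fun _ => id
  | succ n _ ih =>
    rw [derived]
    split_ifs
    · exact fun _ hp => List.mem_cons_of_mem _ (ih hp)
    · exact ih

theorem kaEq_of_mem_derived {e : Exp α} {w : List α} {n : ℕ} :
    ∀ {p}, p ∈ derived e w n → KAEq (linHyp e w) p.1 p.2 := by
  induction n with
  | zero =>
    intro p hp
    rw [derived, List.mem_singleton] at hp
    subst hp
    exact KAEq.refl _
  | succ n ih =>
    intro p hp
    rw [derived] at hp
    split_ifs at hp with h
    · have h₁ := ih h.1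
      have h₂ := ih h.2
      rcases List.mem_cons.1 hp with hp | hp
      · rw [hp]
        exact inference_sound e w n.unpair.1 h₁ h₂
      · exact ih hp
    · exact ih hp

theorem zero_mem_derived (e : Exp α) (w : List α) : ∃ n, ((0, 0) : Exp α × Exp α) ∈ derived e w n :=
  ⟨0, by rw [derived]; exact List.mem_cons_self⟩

theorem exists_mem_derived_of_rule {e : Exp α} {w : List α} (i : ℕ)
    (p : Exp α × Exp α × Exp α × Exp α) {f : Exp α × Exp α × Exp α × Exp α → Inference α}
    (hf : (rules e w)[i]? = some f) (h₁ : ∃ n, (f p).1 ∈ derived e w n)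
    (h₂ : ∃ n, (f p).2.1 ∈ derived e w n) : ∃ n, (f p).2.2 ∈ derived e w n := by
  obtain ⟨m₁, h₁⟩ := h₁
  obtain ⟨m₂, h₂⟩ := h₂
  -- A stage at which the wanted inference is tried and which is no earlier than the stages of both
  -- premises.
  let n := Nat.pair (Encodable.encode (i, p)) (max m₁ m₂)
  have hn : max m₁ m₂ ≤ n := Nat.right_le_pair _ _
  have hi : inference e w n.unpair.1 = f p := by
    rw [Nat.unpair_pair, inference, Denumerable.ofNat_encode, List.getD_eq_getElem?_getD, hf]
    rfl
  refine ⟨n + 1, ?_⟩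
  rw [derived, hi, if_pos ⟨derived_mono e w ((le_max_left _ _).trans hn) h₁,
    derived_mono e w ((le_max_right _ _).trans hn) h₂⟩]
  exact List.mem_cons_self

theorem exists_mem_derived {e : Exp α} {w : List α} {g h : Exp α}
    (d : KAEq (linHyp e w) g h) : ∃ n, (g, h) ∈ derived e w n := by
  have h0 := zero_mem_derived e w
  induction d with
  -- The numbers are positions in `rules`, counted from zero; unused parameters are set to `0`.
  | refl a => exact exists_mem_derived_of_rule 0 (a, 0, 0, 0) rfl h0 h0
  | @symm a b _ h => exact exists_mem_derived_of_rule 1 (a, b, 0, 0) rfl h h0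
  | @trans a b c _ _ h h' => exact exists_mem_derived_of_rule 2 (a, b, c, 0) rfl h h'
  | @add_congr a b c d _ _ h h' => exact exists_mem_derived_of_rule 3 (a, b, c, d) rfl h h'
  | @mul_congr a b c d _ _ h h' => exact exists_mem_derived_of_rule 4 (a, b, c, d) rfl h h'
  | @star_congr a b _ h => exact exists_mem_derived_of_rule 5 (a, b, 0, 0) rfl h h0
  | add_zero a => exact exists_mem_derived_of_rule 6 (a, 0, 0, 0) rfl h0 h0
  | add_idem a => exact exists_mem_derived_of_rule 7 (a, 0, 0, 0) rfl h0 h0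
  | add_comm a b => exact exists_mem_derived_of_rule 8 (a, b, 0, 0) rfl h0 h0
  | add_assoc a b c => exact exists_mem_derived_of_rule 9 (a, b, c, 0) rfl h0 h0
  | mul_zero a => exact exists_mem_derived_of_rule 10 (a, 0, 0, 0) rfl h0 h0
  | zero_mul a => exact exists_mem_derived_of_rule 11 (a, 0, 0, 0) rfl h0 h0
  | mul_one a => exact exists_mem_derived_of_rule 12 (a, 0, 0, 0) rfl h0 h0
  | one_mul a => exact exists_mem_derived_of_rule 13 (a, 0, 0, 0) rfl h0 h0
  | mul_assoc a b c => exact exists_mem_derived_of_rule 14 (a, b, c, 0) rfl h0 h0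
  | mul_add a b c => exact exists_mem_derived_of_rule 15 (a, b, c, 0) rfl h0 h0
  | add_mul a b c => exact exists_mem_derived_of_rule 16 (a, b, c, 0) rfl h0 h0
  | star_unfold_left a => exact exists_mem_derived_of_rule 17 (a, 0, 0, 0) rfl h0 h0
  | star_unfold_right a => exact exists_mem_derived_of_rule 18 (a, 0, 0, 0) rfl h0 h0
  | @star_induct_left a b c _ h => exact exists_mem_derived_of_rule 19 (a, b, c, 0) rfl h h0
  | @star_induct_right a b c _ h => exact exists_mem_derived_of_rule 20 (a, b, c, 0) rfl h h0
  | @hyp a b h =>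
    obtain ⟨rfl, rfl⟩ : a = e ∧ b = ofWord w := Prod.ext_iff.1 h
    exact exists_mem_derived_of_rule 21 (0, 0, 0, 0) rfl h0 h0

end Enumeration

/-! ### Regular languages that avoid a prefix -/

section Avoid

variable {α : Type u}

theorem mem_sum_language {ι : Type*} {s : Finset ι} {f : ι → Language α} {v : List α} :
    v ∈ ∑ i ∈ s, f i ↔ ∃ i ∈ s, v ∈ f i := by
  classical
  induction s using Finset.induction_on with
  | empty => simp
  | insert i s hi ih =>
    rw [Finset.sum_insert hi, Language.mem_add, ih]
    simp

theorem exists_matches_univ [Finite α] : ∃ g : Exp α, ∀ v, v ∈ g.matches' := by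
  have := Fintype.ofFinite α
  obtain ⟨g, hg⟩ := Automaton.exists_matches_eq_sum Finset.univ (fun a : α => ({[a]} : Language α))
    fun a _ => ⟨.char a, rfl⟩
  refine ⟨g.star, fun v => ?_⟩
  induction v with
  | nil => exact one_le_kstar (a := g.matches') rfl
  | cons a v ih =>
    have ha : [a] ∈ g.matches' := by
      rw [hg, mem_sum_language]
      exact ⟨a, Finset.mem_univ a, rfl⟩
    exact mul_kstar_le_kstar (a := g.matches') ⟨[a], ha, v, ih, rfl⟩

/-- The language of the words whose first letter lies in a given set is regular. -/
theorem exists_matches_head [Finite α] (S : Set α) :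
    ∃ g : Exp α, ∀ v, v ∈ g.matches' ↔ ∃ a ∈ S, ∃ v', v = a :: v' := by
  classical
  have := Fintype.ofFinite α
  obtain ⟨t, ht⟩ := exists_matches_univ (α := α)
  obtain ⟨g, hg⟩ := Automaton.exists_matches_eq_sum (Finset.univ.filter (· ∈ S))
    (fun a : α => ({[a]} : Language α)) fun a _ => ⟨.char a, rfl⟩
  refine ⟨g * t, fun v => ?_⟩
  rw [RegularExpression.matches'_mul, hg]
  constructor
  · rintro ⟨u, hu, v, -, rfl⟩
    obtain ⟨a, ha, hu⟩ := mem_sum_language.1 hu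
    obtain rfl := hu
    exact ⟨a, (Finset.mem_filter.1 ha).2, v, rfl⟩
  · rintro ⟨a, ha, v, rfl⟩
    exact ⟨[a], mem_sum_language.2 ⟨a, by simpa using ha, rfl⟩, v, ht v, rfl⟩

/-- The nonempty words. -/
theorem exists_matches_ne_nil [Finite α] : ∃ g : Exp α, ∀ v, v ∈ g.matches' ↔ v ≠ [] := by
  obtain ⟨g, hg⟩ := exists_matches_head (Set.univ : Set α)
  refine ⟨g, fun v => (hg v).trans ?_⟩
  cases v <;> simp

/-- The words that do not start with a given letter. -/
theorem exists_matches_head_ne [Finite α] (a : α) :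
    ∃ g : Exp α, ∀ v, v ∈ g.matches' ↔ ∀ v', v ≠ a :: v' := by
  obtain ⟨g, hg⟩ := exists_matches_head {b | b ≠ a}
  refine ⟨1 + g, fun v => ?_⟩
  rw [RegularExpression.matches'_add, Language.mem_add, hg]
  rcases v with _ | ⟨b, v⟩
  · simp [Language.mem_one]
  · simp [Language.mem_one, eq_comm]

end Avoid

/-! ### Certificates of non-derivability. -/

section Certificate

variable {α : Type u} [Finite α]

/-- The `i`-th letter. -/
noncomputable def letter (i : Fin (Nat.card α)) : α := (Finite.equivFin α).symm i

theorem exists_map_letter (v : List α) : ∃ x : List (Fin (Nat.card α)), x.map letter = v :=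
  ⟨v.map (Finite.equivFin α), by simp [letter, Function.comp_def]⟩

/-- An expression for the words that do not start with the `i`-th letter. -/
noncomputable def headNe (i : Fin (Nat.card α)) : Exp α :=
  (exists_matches_head_ne (letter i)).choose

theorem mem_headNe {i : Fin (Nat.card α)} {v : List α} :
    v ∈ (headNe i).matches' ↔ ∀ v', v ≠ letter i :: v' :=
  (exists_matches_head_ne (letter i)).choose_spec v

/-- An expression for the nonempty words. -/
noncomputable def neNil (α : Type u) [Finite α] : Exp α :=
  (exists_matches_ne_nil (α := α)).choose

theorem mem_neNil {v : List α} : v ∈ (neNil α).matches' ↔ v ≠ [] :=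
  (exists_matches_ne_nil (α := α)).choose_spec v

/-- An expression for the words `v` such that `v = y ++ v'` implies that `g` matches `v'`. -/
noncomputable def avoid (g : Exp α) (y : List (Fin (Nat.card α))) : Exp α :=
  y.foldr (fun i h => headNe i + .char (letter i) * h) g

/-- Thus `r ≤ avoid r' y` says that the derivative of `r` along `y` lies in `r'`. Written as an
inequation it can be certified by a derivation, and no derivative has to be computed. -/
theorem mem_avoid {g : Exp α} {y : List (Fin (Nat.card α))} {v : List α} :
    v ∈ (avoid g y).matches' ↔ ∀ v', v = y.map letter ++ v' → v' ∈ g.matches' := by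
  induction y generalizing v with
  | nil =>
    refine ⟨fun h v' hv => ?_, fun h => h v rfl⟩
    obtain rfl : v = v' := hv
    exact h
  | cons i y ih =>
    change v ∈ (headNe i).matches' + ({[letter i]} : Language α) * (avoid g y).matches' ↔ _
    rw [Language.mem_add, mem_headNe]
    constructor
    · rintro (h | ⟨u, hu, v₁, hv₁, rfl⟩) v' hv
      · exact absurd hv (h _)
      · obtain rfl := hu
        obtain rfl : v₁ = y.map letter ++ v' := by simpa using hv
        exact ih.1 hv₁ v' rfl
    · intro h
      by_cases hv : ∃ v', v = letter i :: v'
      · obtain ⟨v', rfl⟩ := hv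
        exact Or.inr ⟨[letter i], rfl, v', ih.2 fun v'' hv => h v'' (by simp [hv]), rfl⟩
      · exact Or.inl fun v' hv' => hv ⟨v', hv'⟩

/-- The expression of a word. -/
noncomputable def wordExp (y : List (Fin (Nat.card α))) : Exp α :=
  y.foldr (fun i h => .char (letter i) * h) 1

theorem matches_wordExp (y : List (Fin (Nat.card α))) :
    (wordExp y : Exp α).matches' = {y.map letter} := by
  rw [← matches_ofWord]
  induction y with
  | nil => rfl
  | cons i y ih =>
    change ({[letter i]} : Language α) * (wordExp y).matches' = {[letter i]} * _
    rw [ih]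

/-- `g ≤ h` is among the first `n` inequations derived without hypotheses. -/
def DerivedLE (n : ℕ) (g h : Exp α) : Prop := (g + h, h) ∈ derived (0 : Exp α) [] n

theorem DerivedLE.matches_le {n : ℕ} {g h : Exp α} (d : DerivedLE n g h) :
    g.matches' ≤ h.matches' := by
  -- The hypothesis `0 ≤ 1` used in `DerivedLE` is vacuous, so every language is closed under it.
  have hcl : HypClosed (0 : Exp α) [] h.matches' := fun _ _ _ _ hy => False.elim hy
  exact (le_sup_left (a := g.matches')).trans (hcl.matches_le (kaEq_of_mem_derived d) le_rfl)

theorem DerivedLE.mono {m n : ℕ} (hmn : m ≤ n) {g h : Exp α} (d : DerivedLE m g h) :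
    DerivedLE n g h := derived_mono _ _ hmn d

theorem exists_derivedLE {g h : Exp α} (hgh : g.matches' ≤ h.matches') : ∃ n, DerivedLE n g h :=
  exists_mem_derived (KTerm.mk_le_mk.1 (kaLe_of_matches_le _ hgh))

/-- The words along which derivatives are taken in a certificate, and the expressions that replace
them: each letter by itself, and `w` by `e`. -/
noncomputable def replacement (e : Exp α) (y : List (Fin (Nat.card α))) :
    Option (Fin (Nat.card α)) → List (Fin (Nat.card α)) × Exp α
  | none => (y, e)
  | some i => ([i], .char (letter i))

/-- A certificate for the fact that the word `c.2.2` is matched by `g`, but does not belong to the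
hypothesis closure of `h`: a list `c.2.1` of expressions that is closed under derivatives, and a
bound on the lengths of derivations. -/
def Separates (e : Exp α) (y : List (Fin (Nat.card α)))
    (c : ℕ × List (Exp α) × List (Fin (Nat.card α))) (g h : Exp α) : Prop :=
  (∀ i ∈ (Finset.univ : Finset (Option (Fin (Nat.card α)))).toList, ∀ r ∈ c.2.1, ∃ r' ∈ c.2.1,
    DerivedLE c.1 r (avoid r' (replacement e y i).1) ∧
      DerivedLE c.1 ((replacement e y i).2 * r') r) ∧
  ∃ r ∈ c.2.1, DerivedLE c.1 h r ∧ DerivedLE c.1 r (avoid (neNil α) c.2.2) ∧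
    DerivedLE c.1 (wordExp c.2.2) g

/-- The derivative conditions make every language in the list closed under `e ≤ w`. One of them
contains `h` but not the word `c.2.2` of `g`, which soundness would forbid if `g = h` were provable.
-/
theorem Separates.not_kaEq {e : Exp α} {y : List (Fin (Nat.card α))}
    {c : ℕ × List (Exp α) × List (Fin (Nat.card α))} {g h : Exp α} (hc : Separates e y c g h) :
    ¬ KAEq (linHyp e (y.map letter)) g h := by
  obtain ⟨hrow, r, hr, hhr, hrx, hxg⟩ := hc
  have hmem {i : Option (Fin (Nat.card α))} {r' : Exp α} (hr' : r' ∈ c.2.1) :=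
    hrow i (Finset.mem_toList.2 (Finset.mem_univ i)) r' hr'
  -- Induction on the left context: letters of `u` move along the list, and at the empty context the
  -- entry for `none` exchanges `w` for `e`.
  have hclosed : ∀ u, ∀ r ∈ c.2.1, ∀ v, u ++ y.map letter ++ v ∈ r.matches' →
      ∀ z ∈ e.matches', u ++ z ++ v ∈ r.matches' := by
    intro u
    induction u with
    | nil =>
      intro r hr v hv z hz
      obtain ⟨r', hr', h₁, h₂⟩ := hmem (i := none) hr
      exact h₂.matches_le ⟨z, hz, v, mem_avoid.1 (h₁.matches_le hv) v rfl, rfl⟩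
    | cons a u ih =>
      intro r hr v hv z hz
      obtain ⟨i, rfl⟩ : ∃ i, letter i = a := (Finite.equivFin α).symm.surjective a
      obtain ⟨r', hr', h₁, h₂⟩ := hmem (i := some i) hr
      have := ih r' hr' v (mem_avoid.1 (h₁.matches_le hv) _ rfl) z hz
      exact h₂.matches_le ⟨[letter i], rfl, _, this, rfl⟩
  intro d
  have hL : HypClosed e (y.map letter) r.matches' := fun u => hclosed u r hr
  have hg := hL.matches_le d hhr.matches_le
  have hx : c.2.2.map letter ∈ r.matches' :=
    hg (hxg.matches_le (by rw [matches_wordExp]; exact rfl))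
  -- If the word were in `r`, the empty word would have to be nonempty.
  have := mem_avoid.1 (hrx.matches_le hx) [] (List.append_nil _).symm
  exact mem_neNil.1 this rfl

/-- The list consists of expressions for the languages of all sets of states. Sets are needed
because a word leads from a state to several states; their number is finite, and they are closed
under the successor map `δ`. -/
theorem exists_separates {e : Exp α} {y : List (Fin (Nat.card α))} {X : Automaton α}
    [Finite X.State] (hX : X.needsPatch e (y.map letter) = ∅) {g h : Exp α}
    (hh : h.matches' ≤ X.lang) (hg : ¬ g.matches' ≤ X.lang) : ∃ c, Separates e y c g h := by
  classical
  have := Fintype.ofFinite X.State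
  obtain ⟨v, hv, hvX⟩ := Set.not_subset.1 hg
  obtain ⟨x, rfl⟩ := exists_map_letter v
  have hreg (S : Set X.State) :
      ∃ r : Exp α, ∀ v, v ∈ r.matches' ↔ ∃ q ∈ S, v ∈ X.langFrom q := by
    obtain ⟨r, hr⟩ := Automaton.exists_matches_eq_sum (Finset.univ.filter (· ∈ S)) X.langFrom
      fun q _ => X.exists_matches_eq_langFrom q
    exact ⟨r, fun v => by rw [hr, mem_sum_language]; simp⟩
  choose r hr using hreg
  let δ (S : Set X.State) (i : Option (Fin (Nat.card α))) : Set X.State :=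
    {q | ∃ p ∈ S, Trace X.step p ((replacement e y i).1.map letter) q}
  have h₁ (p : Set X.State × Option (Fin (Nat.card α))) :
      ∃ n, DerivedLE n (r p.1) (avoid (r (δ p.1 p.2)) (replacement e y p.2).1) := by
    refine exists_derivedLE fun v hv => mem_avoid.2 ?_
    rintro v' rfl
    obtain ⟨q, hq, hv⟩ := (hr _ _).1 hv
    obtain ⟨q', hq', hv'⟩ := Trace.split hv _ _ rfl
    exact (hr _ _).2 ⟨q', ⟨q, hq, hq'⟩, hv'⟩
  have h₂ (p : Set X.State × Option (Fin (Nat.card α))) :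
      ∃ n, DerivedLE n ((replacement e y p.2).2 * r (δ p.1 p.2)) (r p.1) := by
    refine exists_derivedLE ?_
    rintro _ ⟨z, hz, v, hv, rfl⟩
    obtain ⟨q', ⟨q, hq, hqq'⟩, hv'⟩ := (hr _ _).1 hv
    refine (hr _ _).2 ⟨q, hq, ?_⟩
    rcases p with ⟨S, _ | i⟩
    -- For the entry `none`, the absence of states to patch is exactly what allows `e` in place of
    -- `w`.
    · exact Automaton.mem_langFrom_of_needsPatch_eq_empty hX q (X.langFrom_append hqq' hv') hz
    · obtain rfl := hz
      exact X.langFrom_append hqq' hv'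
  choose n₁ hn₁ using h₁
  choose n₂ hn₂ using h₂
  obtain ⟨m₁, hm₁⟩ := Finite.exists_le n₁
  obtain ⟨m₂, hm₂⟩ := Finite.exists_le n₂
  obtain ⟨m₃, hm₃⟩ := exists_derivedLE (g := h) (h := r {X.start}) fun v hv =>
    (hr _ _).2 ⟨X.start, rfl, hh hv⟩
  obtain ⟨m₄, hm₄⟩ := exists_derivedLE (g := r {X.start}) (h := avoid (neNil α) x) fun v hv =>
    mem_avoid.2 fun v' hv' => by
      refine mem_neNil.2 ?_
      rintro rfl
      obtain ⟨q, rfl, hv⟩ := (hr _ _).1 hv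
      rw [hv', List.append_nil] at hv
      exact hvX hv
  obtain ⟨m₅, hm₅⟩ := exists_derivedLE (g := wordExp x) (h := g) (by
    rw [matches_wordExp]
    rintro _ rfl
    exact hv)
  -- `derived` is monotone, so one bound serves the finitely many inequations.
  let N := m₁ + m₂ + m₃ + m₄ + m₅
  have hmem (S : Set X.State) : r S ∈ (Finset.univ : Finset (Set X.State)).toList.map r :=
    List.mem_map_of_mem (Finset.mem_toList.2 (Finset.mem_univ S))
  refine ⟨(N, (Finset.univ : Finset (Set X.State)).toList.map r, x), ?_, r {X.start}, hmem _,
    hm₃.mono (by omega), hm₄.mono (by omega), hm₅.mono (by omega)⟩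
  rintro i - r' hr'
  obtain ⟨S, -, rfl⟩ := List.mem_map.1 hr'
  have hm₁ := hm₁ (S, i)
  have hm₂ := hm₂ (S, i)
  exact ⟨r (δ S i), hmem _, (hn₁ (S, i)).mono (by omega), (hn₂ (S, i)).mono (by omega)⟩

section Primrec

variable {β : Type*} [Primcodable β]

theorem primrec_avoid {g : β → Exp α} {y : β → List (Fin (Nat.card α))} (hg : Primrec g)
    (hy : Primrec y) : Primrec fun x => avoid (g x) (y x) := by
  refine Primrec.list_foldr hy hg (h := fun _ p => headNe p.1 + RegularExpression.char (letter p.1) * p.2) ?_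
  exact primrec_add ((Primrec.dom_finite headNe).comp (Primrec.fst.comp Primrec.snd))
    (primrec_mul ((Primrec.dom_finite fun i => (.char (letter i) : Exp α)).comp
      (Primrec.fst.comp Primrec.snd)) (Primrec.snd.comp Primrec.snd))

theorem primrec_wordExp {y : β → List (Fin (Nat.card α))} (hy : Primrec y) :
    Primrec fun x => (wordExp (y x) : Exp α) := by
  refine Primrec.list_foldr hy (Primrec.const 1) (h := fun _ p => RegularExpression.char (letter p.1) * p.2) ?_
  exact primrec_mul ((Primrec.dom_finite fun i => (.char (letter i) : Exp α)).comp
    (Primrec.fst.comp Primrec.snd)) (Primrec.snd.comp Primrec.snd)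

theorem primrecPred_derivedLE {n : β → ℕ} {g h : β → Exp α} (hn : Primrec n) (hg : Primrec g)
    (hh : Primrec h) : PrimrecPred fun x => DerivedLE (n x) (g x) (h x) :=
  primrecPred_mem (Primrec.pair (primrec_add hg hh) hh) ((primrec_derived 0 []).comp hn)

theorem primrecPred_separates (e : Exp α) (y : List (Fin (Nat.card α)))
    {c : β → ℕ × List (Exp α) × List (Fin (Nat.card α))} {g h : β → Exp α} (hc : Primrec c)
    (hg : Primrec g) (hh : Primrec h) : PrimrecPred fun x => Separates e y (c x) (g x) (h x) := by
  have hn : Primrec fun x => (c x).1 := Primrec.fst.comp hc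
  have hl : Primrec fun x => (c x).2.1 := Primrec.fst.comp (Primrec.snd.comp hc)
  have hx : Primrec fun x => (c x).2.2 := Primrec.snd.comp (Primrec.snd.comp hc)
  refine PrimrecPred.and ?_ ?_
  · refine primrecPred_forall_mem (Primrec.const _) ?_
    refine primrecPred_forall_mem (hl.comp Primrec.fst) ?_
    refine primrecPred_exists_mem (hl.comp (Primrec.fst.comp Primrec.fst)) ?_
    have hn' := hn.comp (Primrec.fst.comp (Primrec.fst.comp
      (Primrec.fst (α := (β × Option (Fin (Nat.card α))) × Exp α) (β := Exp α))))
    have hi := (Primrec.dom_finite (replacement e y)).comp (Primrec.snd.comp (Primrec.fst.comp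
      (Primrec.fst (α := (β × Option (Fin (Nat.card α))) × Exp α) (β := Exp α))))
    exact PrimrecPred.and
      (primrecPred_derivedLE hn' (Primrec.snd.comp Primrec.fst)
        (primrec_avoid Primrec.snd (Primrec.fst.comp hi)))
      (primrecPred_derivedLE hn' (primrec_mul (Primrec.snd.comp hi) Primrec.snd)
        (Primrec.snd.comp Primrec.fst))
  · refine primrecPred_exists_mem hl ?_
    have hn' := hn.comp (Primrec.fst (α := β) (β := Exp α))
    have hx' := hx.comp (Primrec.fst (α := β) (β := Exp α))
    exact (primrecPred_derivedLE hn' (hh.comp Primrec.fst) Primrec.snd).and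
      ((primrecPred_derivedLE hn' Primrec.snd (primrec_avoid (Primrec.const _) hx')).and
        (primrecPred_derivedLE hn' (primrec_wordExp hx') (hg.comp Primrec.fst)))

end Primrec

end Certificate

/-! ### Decidability -/

/-- Search for the least witness of either answer: on `D` one exists, so the search halts, and both
kinds of witness are reliable. Outside `D` it may diverge. -/
theorem decidableOn_of_primrecPred {β : Type u} [Primcodable β] {D : Set β} {p : β → Prop}
    {P N : β × ℕ → Prop} (hP : PrimrecPred P) (hN : PrimrecPred N) (hPp : ∀ x n, P (x, n) → p x)
    (hNp : ∀ x n, N (x, n) → ¬ p x) (hex : ∀ x ∈ D, ∃ n, P (x, n) ∨ N (x, n)) :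
    DecidableOn D p := by
  classical
  have hf : Computable₂ fun (x : β) (n : ℕ) => decide (P (x, n) ∨ N (x, n)) :=
    ((hP.or hN).decide).to_comp
  have hg : Computable₂ fun (x : β) (n : ℕ) => decide (P (x, n)) := hP.decide.to_comp
  refine ⟨_, (Partrec.rfind hf.partrec₂).map hg, fun x hx => ?_⟩
  obtain ⟨n, hn⟩ := hex x hx
  obtain ⟨m, hm, -⟩ := Nat.rfind_min' (p := fun n => decide (P (x, n) ∨ N (x, n)))
    (m := n) (by simpa using hn)
  refine ⟨_, Part.mem_map _ hm, ?_⟩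
  have hm' : P (x, m) ∨ N (x, m) := by simpa using Nat.rfind_spec hm
  rw [decide_eq_true_iff]
  exact ⟨hPp x m, fun hp => hm'.resolve_right fun h => hNp x m h hp⟩

theorem DecidableOn.computablePred {β : Type u} [Primcodable β] {D : Set β} {p : β → Prop}
    (h : DecidableOn D p) (hD : ∀ x, x ∈ D) : ComputablePred p := by
  classical
  obtain ⟨f, hf, hfp⟩ := h
  refine ⟨Classical.decPred p, hf.of_eq fun x => ?_⟩
  obtain ⟨b, hb, hbp⟩ := hfp x (hD x)
  rw [Part.eq_some_iff.2 hb]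
  exact congrArg Part.some (Bool.eq_iff_iff.2 (hbp.trans (decide_eq_true_iff).symm))

/-- The search consults neither `T` nor the automata; these only guarantee that it halts. -/
theorem decidableOn_kaEq {α : Type u} [Finite α] (T : Translation α) (e : Exp α) (w : List α) :
    DecidableOn {p : Exp α × Exp α | (rH T e w p.1).Dom ∧ (rH T e w p.2).Dom}
      (fun p => KAEq (linHyp e w) p.1 p.2) := by
  obtain ⟨y, rfl⟩ := exists_map_letter w
  let cert (n : ℕ) : ℕ × List (Exp α) × List (Fin (Nat.card α)) :=
    (Encodable.decode n).getD (0, [], [])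
  have hc : Primrec fun q : (Exp α × Exp α) × ℕ => cert q.2 :=
    Primrec.option_getD.comp (Primrec.decode.comp Primrec.snd) (Primrec.const (0, [], []))
  have hg : Primrec fun q : (Exp α × Exp α) × ℕ => q.1.1 := Primrec.fst.comp Primrec.fst
  have hh : Primrec fun q : (Exp α × Exp α) × ℕ => q.1.2 := Primrec.snd.comp Primrec.fst
  -- Refuting `g ≤ h` needs definedness at `h` alone; refuting an equation may need either
  -- direction.
  have hex {g h : Exp α} (hd : (rH T e (y.map letter) h).Dom)
      (hgh : ¬ KALe (linHyp e (y.map letter)) g h) : ∃ n, Separates e y (cert n) g h := by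
    obtain ⟨X, _, hX, hXh, hXle⟩ := exists_closed_automaton T e (y.map letter) hd
    obtain ⟨c, hc⟩ := exists_separates hX hXh (mt (hXle g) hgh)
    refine ⟨Encodable.encode c, ?_⟩
    change Separates e y ((Encodable.decode (Encodable.encode c)).getD (0, [], [])) g h
    rwa [Encodable.encodek, Option.getD_some]
  refine decidableOn_of_primrecPred
    (P := fun q => q.1 ∈ derived e (y.map letter) q.2)
    (N := fun q => Separates e y (cert q.2) q.1.1 q.1.2 ∨ Separates e y (cert q.2) q.1.2 q.1.1)
    (primrecPred_mem Primrec.fst ((primrec_derived e (y.map letter)).comp Primrec.snd))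
    ((primrecPred_separates e y hc hg hh).or (primrecPred_separates e y hc hh hg))
    (fun p n hp => kaEq_of_mem_derived hp) ?_ ?_
  · rintro p n (h | h) hp
    · exact h.not_kaEq hp
    · exact h.not_kaEq hp.symm
  · rintro ⟨g, h⟩ ⟨hdg, hdh⟩
    by_cases hgh : KALe (linHyp e (y.map letter)) g h
    · by_cases hhg : KALe (linHyp e (y.map letter)) h g
      · obtain ⟨n, hn⟩ := exists_mem_derived (hgh.antisymm hhg)
        exact ⟨n, Or.inl hn⟩
      · obtain ⟨n, hn⟩ := hex hdg hhg
        exact ⟨n, Or.inr (Or.inr hn)⟩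
    · obtain ⟨n, hn⟩ := hex hdh hgh
      exact ⟨n, Or.inr (Or.inl hn)⟩

end KAHyp

theorem mainTheorem2 {α : Type*} [Finite α] (T : KAHyp.Translation α)
    (e : KAHyp.Exp α) (w : List α) :
    (∀ g h : KAHyp.Exp α, (KAHyp.rH T e w g).Dom → (KAHyp.rH T e w h).Dom →
      KAHyp.semH (KAHyp.linHyp e w) g = KAHyp.semH (KAHyp.linHyp e w) h →
      KAHyp.KAEq (KAHyp.linHyp e w) g h) ∧
    KAHyp.DecidableOn
      {p : KAHyp.Exp α × KAHyp.Exp α | (KAHyp.rH T e w p.1).Dom ∧ (KAHyp.rH T e w p.2).Dom}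
      (fun p => KAHyp.KAEq (KAHyp.linHyp e w) p.1 p.2) ∧
    ((∀ g : KAHyp.Exp α, (KAHyp.rH T e w g).Dom) →
      (∀ g h : KAHyp.Exp α,
        KAHyp.semH (KAHyp.linHyp e w) g = KAHyp.semH (KAHyp.linHyp e w) h →
        KAHyp.KAEq (KAHyp.linHyp e w) g h) ∧
      ComputablePred (fun p : KAHyp.Exp α × KAHyp.Exp α =>
        KAHyp.KAEq (KAHyp.linHyp e w) p.1 p.2)) :=
  ⟨fun _ _ => KAHyp.kaEq_of_semH_eq T e w, KAHyp.decidableOn_kaEq T e w,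
    fun hdef => ⟨fun g h => KAHyp.kaEq_of_semH_eq T e w (hdef g) (hdef h),
      (KAHyp.decidableOn_kaEq T e w).computablePred fun p => ⟨hdef p.1, hdef p.2⟩⟩⟩
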